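/- A super-ring is a unital ring $A=A_0\oplus A_1$ graded by $\mathbb Z/2$ that is super-commutative: even elements commute with all homogeneous elements, and $s^2=0$ for every $s\in A_1$. A super-ideal is a homogeneous ideal; $A$ is Noetherian if its super-ideals satisfy the ascending chain condition. A super-ideal $\mathfrak p$ is called maximal if $A/\mathfrak p$ is a field, and $(A,\mathfrak m)$ is local if $\mathfrak m$ is the unique maximal super-ideal of $A$. Odd elements $y_1,\dots,y_s\in A_1$ form a system of odd parameters if $\mathrm{Kdim}(A_0)=\mathrm{Kdim}\bigl(A_0/\mathrm{Ann}_{A_0}(y_1\cdots y_s)\bigr)$, where $\mathrm{Kdim}$ is the Krull dimension (for $s=0$ the product is $1$). The Krull super-dimension is $\mathrm{Ksdim}(A)=r\mid s$, where $r=\mathrm{Kdim}(A_0)$ and $s$ is the largest length of a system of odd parameters. Let $(A,\mathfrak m)$ be a Noetherian local super-ring with residue field $K=A/\mathfrak m$. Then $\mathfrak m/\mathfrak m^2$ is a super-vector space over $K$ whose component $(\mathfrak m/\mathfrak m^2)_i$ is the image of $\mathfrak m\cap A_i$ ($i=0,1$), and $\mathrm{sdim}_K(\mathfrak m/\mathfrak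 m^2)=\dim_K(\mathfrak m/\mathfrak m^2)_0\mid\dim_K(\mathfrak m/\mathfrak m^2)_1$. The super-ring $A$ is called regular if $\mathrm{Ksdim}(A)=\mathrm{sdim}_K(\mathfrak m/\mathfrak m^2)$. Let $\mathrm{gr}_{\mathfrak m}(A)=\bigoplus_{n\ge0}\mathfrak m^n/\mathfrak m^{n+1}$, a graded $K$-superalgebra, and let $$\kappa_A: S_K\bigl((\mathfrak m/\mathfrak m^2)_0\bigr)\otimes_K\wedge_K\bigl((\mathfrak m/\mathfrak m^2)_1\bigr)\to \mathrm{gr}_{\mathfrak m}(A)$$ be the graded $K$-superalgebra map from the tensor product of the symmetric and the exterior algebra that is induced by the inclusion of $\mathfrak m/\mathfrak m^2$ in $\mathrm{gr}_{\mathfrak m}(A)$ as the degree-one component. Theorem. The map $\kappa_A$ is surjective, and $A$ is regular if and only if $\kappa_A$ is an isomorphism. -/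

import Mathlib

open scoped TensorProduct DirectSum

namespace SuperRing


universe u

/-! ### Super-commutative super-rings -/

section Basic

variable {A : Type u} [Ring A]

/-- A super-ring `A = A₀ ⊕ A₁` (a `ℤ/2`-graded ring) is super-commutative if even elements are
central (it suffices that they commute with homogeneous elements) and odd elements square to
zero. -/
class SuperCommutative (𝒜 : ZMod 2 → AddSubgroup A) : Prop where
  even_comm : ∀ {i : ZMod 2} {r s : A}, r ∈ 𝒜 0 → s ∈ 𝒜 i → r * s = s * r
  odd_sq : ∀ {s : A}, s ∈ 𝒜 1 → s * s = 0

variable (𝒜 : ZMod 2 → AddSubgroup A) [GradedRing 𝒜]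

theorem eq_even_add_odd (a : A) :
    a = (DirectSum.decompose 𝒜 a 0 : A) + (DirectSum.decompose 𝒜 a 1 : A) := by
  classical
  conv_lhs => rw [← DirectSum.sum_support_decompose 𝒜 a]
  rw [Finset.sum_subset (Finset.subset_univ _) (fun i _ hi => by
    rw [DFinsupp.notMem_support_iff.1 hi, ZeroMemClass.coe_zero])]
  exact Fin.sum_univ_two _

theorem exists_even_add_odd (a : A) : ∃ b ∈ 𝒜 0, ∃ c ∈ 𝒜 1, a = b + c :=
  ⟨_, (DirectSum.decompose 𝒜 a 0).2, _, (DirectSum.decompose 𝒜 a 1).2, eq_even_add_odd 𝒜 a⟩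

/-- A super-ring is Noetherian if its super-ideals (homogeneous ideals) satisfy the ascending
chain condition. -/
abbrev IsNoetherianSuperRing : Prop := WellFoundedGT (HomogeneousIdeal 𝒜)

variable [SuperCommutative 𝒜]

theorem even_commute {r : A} (hr : r ∈ 𝒜 0) (s : A) : r * s = s * r := by
  obtain ⟨b, hb, c, hc, rfl⟩ := exists_even_add_odd 𝒜 s
  rw [mul_add, add_mul, SuperCommutative.even_comm hr hb, SuperCommutative.even_comm hr hc]

theorem odd_anticommute {r s : A} (hr : r ∈ 𝒜 1) (hs : s ∈ 𝒜 1) : r * s = -(s * r) := by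
  have h := SuperCommutative.odd_sq (𝒜 := 𝒜) ((𝒜 1).add_mem hr hs)
  have h1 := SuperCommutative.odd_sq (𝒜 := 𝒜) hr
  have h2 := SuperCommutative.odd_sq (𝒜 := 𝒜) hs
  rw [mul_add, add_mul, add_mul, h1, h2, zero_add, add_zero] at h
  exact eq_neg_of_add_eq_zero_right h

/-- The even part of a super-commutative super-ring is a commutative ring. -/
instance evenCommRing : CommRing (𝒜 0) where
  __ := SetLike.GradeZero.instRing 𝒜
  mul_comm a b := Subtype.ext (even_commute 𝒜 a.2 b)

/-- Every (left) super-ideal of a super-commutative super-ring is two-sided. -/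
instance isTwoSided (I : HomogeneousIdeal 𝒜) : I.toIdeal.IsTwoSided where
  mul_mem_of_left {a} b ha := by
    have h0 : (DirectSum.decompose 𝒜 a 0 : A) ∈ I.toIdeal := I.isHomogeneous 0 ha
    have h1 : (DirectSum.decompose 𝒜 a 1 : A) ∈ I.toIdeal := I.isHomogeneous 1 ha
    obtain ⟨c, hc, d, hd, rfl⟩ := exists_even_add_odd 𝒜 b
    rw [mul_add, ← even_commute 𝒜 hc]
    refine add_mem (I.toIdeal.mul_mem_left _ ha) ?_
    rw [eq_even_add_odd 𝒜 a, add_mul,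
      even_commute 𝒜 (DirectSum.decompose 𝒜 a 0).2 d,
      odd_anticommute 𝒜 (DirectSum.decompose 𝒜 a 1).2 hd]
    exact add_mem (I.toIdeal.mul_mem_left _ h0) (neg_mem (I.toIdeal.mul_mem_left _ h1))

variable {𝒜}

/-- A super-ideal `𝔪` is maximal if `A / 𝔪` is a field. -/
class IsMaximalSuperIdeal (m : HomogeneousIdeal 𝒜) : Prop where
  isField : IsField (A ⧸ m.toIdeal)

/-- `(A, 𝔪)` is a local super-ring: `𝔪` is the unique maximal super-ideal of `A`. -/
class IsLocalSuperRing (m : HomogeneousIdeal 𝒜) : Prop extends IsMaximalSuperIdeal m where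
  unique : ∀ n : HomogeneousIdeal 𝒜, IsMaximalSuperIdeal n → n = m

/-! ### Krull super-dimension -/

variable (𝒜)

/-- The ideal `Ann_{A₀}(a)` of the even part. -/
def evenAnnihilator (a : A) : Ideal (𝒜 0) where
  carrier := {r | (r : A) * a = 0}
  add_mem' {r s} hr hs := by
    change ((r + s : 𝒜 0) : A) * a = 0
    rw [AddSubgroup.coe_add, add_mul, show (r : A) * a = 0 from hr, show (s : A) * a = 0 from hs,
      add_zero]
  zero_mem' := zero_mul a
  smul_mem' r s hs := by
    change ((r : A) * (s : A)) * a = 0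
    rw [mul_assoc, show (s : A) * a = 0 from hs, mul_zero]

/-- The odd elements `y₁, …, yₛ` form a system of odd parameters if
`Kdim A₀ = Kdim (A₀ / Ann_{A₀}(y₁ ⋯ yₛ))`. -/
def IsSystemOfOddParameters {s : ℕ} (y : Fin s → 𝒜 1) : Prop :=
  ringKrullDim (𝒜 0) =
    ringKrullDim (𝒜 0 ⧸ evenAnnihilator 𝒜 (List.ofFn fun i => (y i : A)).prod)

/-- The even Krull dimension: the Krull dimension of `A₀`. -/
noncomputable def evenKrullDim : WithBot ℕ∞ := ringKrullDim (𝒜 0)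

/-- The odd Krull dimension: the largest size of a system of odd parameters. -/
noncomputable def oddKrullDim : ℕ∞ :=
  ⨆ (s : ℕ) (_ : ∃ y : Fin s → 𝒜 1, IsSystemOfOddParameters 𝒜 y), (s : ℕ∞)

/-- The Krull super-dimension `r | s`. -/
noncomputable def krullSuperDim : WithBot ℕ∞ × ℕ∞ := (evenKrullDim 𝒜, oddKrullDim 𝒜)

end Basic

/-! ### The associated graded ring of a two-sided ideal -/

section Gr

variable {A : Type u} [Ring A] (I : Ideal A)

/-- The quotient `Iⁿ / Iⁿ⁺¹`. -/
def GrPiece (n : ℕ) : Type u := ↥(I ^ n) ⧸ (I ^ (n + 1)).submoduleOf (I ^ n)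

instance (n : ℕ) : AddCommGroup (GrPiece I n) :=
  inferInstanceAs (AddCommGroup (↥(I ^ n) ⧸ (I ^ (n + 1)).submoduleOf (I ^ n)))

instance (n : ℕ) : Module A (GrPiece I n) :=
  inferInstanceAs (Module A (↥(I ^ n) ⧸ (I ^ (n + 1)).submoduleOf (I ^ n)))

/-- The class of an element of `Iⁿ` in `Iⁿ / Iⁿ⁺¹`. -/
def grMk (n : ℕ) : ↥(I ^ n) →ₗ[A] GrPiece I n := ((I ^ (n + 1)).submoduleOf (I ^ n)).mkQ

variable {I}

theorem grMk_surjective (n : ℕ) : Function.Surjective (grMk I n) := Submodule.mkQ_surjective _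

theorem grMk_eq_iff {n : ℕ} {a b : ↥(I ^ n)} :
    grMk I n a = grMk I n b ↔ (a : A) - b ∈ I ^ (n + 1) :=
  Submodule.Quotient.eq _

theorem gradedMonoid_mk_congr {i j : ℕ} {a : ↥(I ^ i)} {b : ↥(I ^ j)} (h : i = j)
    (hab : (a : A) - b ∈ I ^ (j + 1)) :
    (GradedMonoid.mk i (grMk I i a) : GradedMonoid (GrPiece I)) =
      GradedMonoid.mk j (grMk I j b) := by
  subst h
  rw [grMk_eq_iff.2 hab]

variable [I.IsTwoSided]

theorem mul_mem_pow_add {i j : ℕ} {a b : A} (ha : a ∈ I ^ i) (hb : b ∈ I ^ j) :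
    a * b ∈ I ^ (i + j) := by
  rw [Ideal.IsTwoSided.pow_add]
  exact Ideal.mul_mem_mul ha hb

variable (I)

/-- The multiplication `Iⁱ / Iⁱ⁺¹ × Iʲ / Iʲ⁺¹ → Iⁱ⁺ʲ / Iⁱ⁺ʲ⁺¹`, `(ā, b̄) ↦ class of ab`. -/
def grMul {i j : ℕ} (x : GrPiece I i) (y : GrPiece I j) : GrPiece I (i + j) :=
  Quotient.map₂ (fun a b => (⟨a.1 * b.1, mul_mem_pow_add a.2 b.2⟩ : ↥(I ^ (i + j))))
    (fun a a' h b b' h' => by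
      rw [← Quotient.eq_iff_equiv] at h h' ⊢
      have h1 : a.1 - a'.1 ∈ I ^ (i + 1) := grMk_eq_iff.1 h
      have h2 : b.1 - b'.1 ∈ I ^ (j + 1) := grMk_eq_iff.1 h'
      refine grMk_eq_iff.2 ?_
      have e : a.1 * b.1 - a'.1 * b'.1 = (a.1 - a'.1) * b.1 + a'.1 * (b.1 - b'.1) := by
        noncomm_ring
      change a.1 * b.1 - a'.1 * b'.1 ∈ _
      rw [e]
      have h3 : (a.1 - a'.1) * b.1 ∈ I ^ (i + 1 + j) := mul_mem_pow_add h1 b.2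
      have h4 : a'.1 * (b.1 - b'.1) ∈ I ^ (i + (j + 1)) := mul_mem_pow_add a'.2 h2
      rw [add_right_comm] at h3
      rw [← add_assoc] at h4
      exact add_mem h3 h4) x y

theorem grMul_grMk {i j : ℕ} (a : ↥(I ^ i)) (b : ↥(I ^ j)) :
    grMul I (grMk I i a) (grMk I j b) =
      grMk I (i + j) ⟨a.1 * b.1, mul_mem_pow_add a.2 b.2⟩ := rfl

theorem one_mem_pow_zero : (1 : A) ∈ I ^ 0 := by
  rw [Submodule.pow_zero, Ideal.one_eq_top]
  trivial

instance : GradedMonoid.GMul (GrPiece I) := ⟨fun x y => grMul I x y⟩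

instance : GradedMonoid.GOne (GrPiece I) := ⟨grMk I 0 ⟨1, one_mem_pow_zero I⟩⟩

theorem gradedMonoid_mk_mul_mk {i j : ℕ} (a : ↥(I ^ i)) (b : ↥(I ^ j)) :
    (GradedMonoid.mk i (grMk I i a) * GradedMonoid.mk j (grMk I j b) :
      GradedMonoid (GrPiece I)) =
      GradedMonoid.mk (i + j) (grMk I (i + j) ⟨a.1 * b.1, mul_mem_pow_add a.2 b.2⟩) := rfl

theorem gradedMonoid_one :
    (1 : GradedMonoid (GrPiece I)) = GradedMonoid.mk 0 (grMk I 0 ⟨1, one_mem_pow_zero I⟩) := rfl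

instance grRing : DirectSum.GRing (GrPiece I) where
  mul_zero {i j} x := by
    obtain ⟨a, rfl⟩ := grMk_surjective i x
    rw [← map_zero (grMk I j)]
    refine (grMul_grMk I a 0).trans ?_
    rw [← map_zero (grMk I (i + j))]
    congr 1
    exact Subtype.ext (mul_zero _)
  zero_mul {i j} x := by
    obtain ⟨a, rfl⟩ := grMk_surjective j x
    rw [← map_zero (grMk I i)]
    refine (grMul_grMk I 0 a).trans ?_
    rw [← map_zero (grMk I (i + j))]
    congr 1
    exact Subtype.ext (zero_mul _)
  mul_add {i j} x y z := by
    obtain ⟨a, rfl⟩ := grMk_surjective i x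
    obtain ⟨b, rfl⟩ := grMk_surjective j y
    obtain ⟨c, rfl⟩ := grMk_surjective j z
    rw [← map_add]
    refine (grMul_grMk I a (b + c)).trans ?_
    change _ = grMul I _ _ + grMul I _ _
    rw [grMul_grMk, grMul_grMk, ← map_add]
    congr 1
    exact Subtype.ext (mul_add _ _ _)
  add_mul {i j} x y z := by
    obtain ⟨a, rfl⟩ := grMk_surjective i x
    obtain ⟨b, rfl⟩ := grMk_surjective i y
    obtain ⟨c, rfl⟩ := grMk_surjective j z
    rw [← map_add]
    refine (grMul_grMk I (a + b) c).trans ?_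
    change _ = grMul I _ _ + grMul I _ _
    rw [grMul_grMk, grMul_grMk, ← map_add]
    congr 1
    exact Subtype.ext (add_mul _ _ _)
  one_mul := by
    rintro ⟨i, x⟩
    obtain ⟨a, rfl⟩ := grMk_surjective i x
    rw [gradedMonoid_one]
    refine (gradedMonoid_mk_mul_mk I _ a).trans (gradedMonoid_mk_congr (zero_add i) ?_)
    simp
  mul_one := by
    rintro ⟨i, x⟩
    obtain ⟨a, rfl⟩ := grMk_surjective i x
    rw [gradedMonoid_one]
    refine (gradedMonoid_mk_mul_mk I a _).trans (gradedMonoid_mk_congr (add_zero i) ?_)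
    simp
  mul_assoc := by
    rintro ⟨i, x⟩ ⟨j, y⟩ ⟨k, z⟩
    obtain ⟨a, rfl⟩ := grMk_surjective i x
    obtain ⟨b, rfl⟩ := grMk_surjective j y
    obtain ⟨c, rfl⟩ := grMk_surjective k z
    refine (gradedMonoid_mk_congr (add_assoc i j k) ?_ :
      GradedMonoid.mk _ (grMk I (i + j + k)
        ⟨(a.1 * b.1) * c.1, mul_mem_pow_add (mul_mem_pow_add a.2 b.2) c.2⟩) =
      GradedMonoid.mk _ (grMk I (i + (j + k))
        ⟨a.1 * (b.1 * c.1), mul_mem_pow_add a.2 (mul_mem_pow_add b.2 c.2)⟩))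
    simp [mul_assoc]
  natCast n := n • GradedMonoid.GOne.one
  natCast_zero := zero_smul _ _
  natCast_succ n := succ_nsmul _ n
  intCast n := n • GradedMonoid.GOne.one
  intCast_ofNat n := natCast_zsmul _ n
  intCast_negSucc_ofNat n := negSucc_zsmul _ n

end Gr

/-! ### The cotangent super-space and the map `κ` -/

section Kappa

variable {A : Type u} [Ring A] {𝒜 : ZMod 2 → AddSubgroup A} [GradedRing 𝒜] [SuperCommutative 𝒜]
variable (m : HomogeneousIdeal 𝒜)

/-- `K = A / 𝔪`. -/
abbrev ResidueField : Type u := A ⧸ m.toIdeal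

/-- `gr_𝔪(A) = ⨁ₙ 𝔪ⁿ / 𝔪ⁿ⁺¹`. -/
abbrev Gr : Type u := ⨁ n : ℕ, GrPiece m.toIdeal n

variable [hm : IsMaximalSuperIdeal m]

noncomputable instance residueField : Field (ResidueField m) where
  __ := Ideal.Quotient.ring m.toIdeal
  __ := hm.isField.toField

theorem isTorsionBySet_grPiece (n : ℕ) :
    Module.IsTorsionBySet A (GrPiece m.toIdeal n) (m.toIdeal : Set A) := by
  rintro x ⟨a, ha⟩
  obtain ⟨b, rfl⟩ := grMk_surjective n x
  change a • _ = _
  rw [← map_smul, ← map_zero (grMk m.toIdeal n), grMk_eq_iff]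
  have : a * b.1 ∈ m.toIdeal ^ (n + 1) := by
    rw [Ideal.IsTwoSided.pow_succ]
    exact Ideal.mul_mem_mul ha b.2
  simpa using this

/-- `𝔪ⁿ / 𝔪ⁿ⁺¹` is a `K`-vector space through left multiplication. -/
noncomputable instance grPieceModule (n : ℕ) :
    Module (ResidueField m) (GrPiece m.toIdeal n) :=
  (isTorsionBySet_grPiece m n).module

theorem mk_smul_grMk {n : ℕ} (a : A) (b : ↥(m.toIdeal ^ n)) :
    (Ideal.Quotient.mk m.toIdeal a : ResidueField m) • grMk m.toIdeal n b =
      grMk m.toIdeal n (a • b) := rfl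

theorem odd_mem {a : A} (ha : a ∈ 𝒜 1) : a ∈ m.toIdeal := by
  have h : (Ideal.Quotient.mk m.toIdeal a : ResidueField m) * Ideal.Quotient.mk m.toIdeal a = 0 := by
    rw [← map_mul, SuperCommutative.odd_sq ha, map_zero]
  exact Ideal.Quotient.eq_zero_iff_mem.1 (mul_self_eq_zero.1 h)

theorem odd_mul_mem {n : ℕ} {a b : A} (ha : a ∈ 𝒜 1) (hb : b ∈ m.toIdeal ^ n) :
    a * b ∈ m.toIdeal ^ (n + 1) := by
  rw [Ideal.IsTwoSided.pow_succ]
  exact Ideal.mul_mem_mul (odd_mem m ha) hb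

theorem mul_sub_mul_mem {n : ℕ} (a : A) {b : A} (hb : b ∈ m.toIdeal ^ n) :
    a * b - b * a ∈ m.toIdeal ^ (n + 1) := by
  obtain ⟨c, hc, d, hd, rfl⟩ := exists_even_add_odd 𝒜 a
  rw [add_mul, mul_add, even_commute 𝒜 hc, add_sub_add_left_eq_sub]
  refine sub_mem (odd_mul_mem m hd hb) ?_
  have hd' : d ∈ m.toIdeal ^ 1 := by rw [Submodule.pow_one]; exact odd_mem m hd
  exact mul_mem_pow_add hb hd'

/-- `gr_𝔪(A)` is a graded `K`-algebra. -/
noncomputable instance grAlgebra : DirectSum.GAlgebra (ResidueField m) (GrPiece m.toIdeal) where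
  toFun := AddMonoidHom.flip (smulAddHom (ResidueField m) (GrPiece m.toIdeal 0))
    GradedMonoid.GOne.one
  map_one := one_smul (ResidueField m) (GradedMonoid.GOne.one : GrPiece m.toIdeal 0)
  map_mul r s := by
    obtain ⟨a, rfl⟩ := Ideal.Quotient.mk_surjective r
    obtain ⟨b, rfl⟩ := Ideal.Quotient.mk_surjective s
    refine (gradedMonoid_mk_congr (I := m.toIdeal) (i := 0) (j := 0 + 0)
      (a := (a * b) • ⟨1, one_mem_pow_zero _⟩)
      (b := ⟨(a • (1 : A)) * (b • (1 : A)), mul_mem_pow_add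
        (Submodule.smul_mem _ a (one_mem_pow_zero _))
        (Submodule.smul_mem _ b (one_mem_pow_zero _))⟩) rfl ?_)
    simp
  commutes r x := by
    obtain ⟨a, rfl⟩ := Ideal.Quotient.mk_surjective r
    obtain ⟨n, x⟩ := x
    obtain ⟨b, rfl⟩ := grMk_surjective n x
    refine (gradedMonoid_mk_congr (I := m.toIdeal) (i := 0 + n) (j := n + 0)
      (a := ⟨(a • (1 : A)) * b.1, mul_mem_pow_add
        (Submodule.smul_mem _ a (one_mem_pow_zero _)) b.2⟩)
      (b := ⟨b.1 * (a • (1 : A)), mul_mem_pow_add b.2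
        (Submodule.smul_mem _ a (one_mem_pow_zero _))⟩) (by omega) ?_)
    simpa using mul_sub_mul_mem m a b.2
  smul_def r x := by
    obtain ⟨a, rfl⟩ := Ideal.Quotient.mk_surjective r
    obtain ⟨n, x⟩ := x
    obtain ⟨b, rfl⟩ := grMk_surjective n x
    refine (gradedMonoid_mk_congr (I := m.toIdeal) (i := n) (j := 0 + n) (a := a • b)
      (b := ⟨(a • (1 : A)) * b.1, mul_mem_pow_add
        (Submodule.smul_mem _ a (one_mem_pow_zero _)) b.2⟩) (by omega) ?_)
    simp

/-- The homogeneous component `(𝔪/𝔪²)ᵢ` of the super-vector space `𝔪/𝔪²`: the classes of the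
elements of `𝔪 ∩ Aᵢ`. Here `𝔪/𝔪²` is the degree-one piece of `gr_𝔪(A)`. -/
def cotangentPart (i : ZMod 2) : Submodule (ResidueField m) (GrPiece m.toIdeal 1) where
  carrier := {x | ∃ a : ↥(m.toIdeal ^ 1), (a : A) ∈ 𝒜 i ∧ grMk m.toIdeal 1 a = x}
  add_mem' := by
    rintro _ _ ⟨a, ha, rfl⟩ ⟨b, hb, rfl⟩
    exact ⟨a + b, (𝒜 i).add_mem ha hb, map_add _ _ _⟩
  zero_mem' := ⟨0, (𝒜 i).zero_mem, map_zero _⟩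
  smul_mem' := by
    rintro r _ ⟨a, ha, rfl⟩
    obtain ⟨c, rfl⟩ := Ideal.Quotient.mk_surjective r
    obtain ⟨d, hd, e, he, rfl⟩ := exists_even_add_odd 𝒜 c
    refine ⟨d • a, ?_, ?_⟩
    · have := SetLike.mul_mem_graded hd ha
      rwa [zero_add] at this
    · rw [mk_smul_grMk, grMk_eq_iff]
      have : d * a.1 - (d + e) * a.1 = -(e * a.1) := by rw [add_mul]; abel
      change d * a.1 - (d + e) * a.1 ∈ _
      rw [this]
      exact neg_mem (odd_mul_mem m he a.2)

/-- The super-dimension `sdim_K(𝔪/𝔪²) = dim_K (𝔪/𝔪²)₀ | dim_K (𝔪/𝔪²)₁`. -/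
noncomputable def cotangentSuperDim : ℕ∞ × ℕ∞ :=
  (Cardinal.toENat (Module.rank (ResidueField m) (cotangentPart m 0)),
    Cardinal.toENat (Module.rank (ResidueField m) (cotangentPart m 1)))

/-- A local super-ring `(A, 𝔪)` is regular if `Ksdim(A) = sdim_K(𝔪/𝔪²)`. -/
def IsRegular : Prop :=
  krullSuperDim 𝒜 = (((cotangentSuperDim m).1 : WithBot ℕ∞), (cotangentSuperDim m).2)

/-- The embedding `(𝔪/𝔪²)ᵢ → gr_𝔪(A)`. -/
noncomputable def cotangentIncl (i : ZMod 2) : cotangentPart m i →ₗ[ResidueField m] Gr m :=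
  DirectSum.lof (ResidueField m) ℕ (GrPiece m.toIdeal) 1 ∘ₗ (cotangentPart m i).subtype

theorem cotangentIncl_even_comm (i : ZMod 2) (x : cotangentPart m 0) (y : cotangentPart m i) :
    cotangentIncl m 0 x * cotangentIncl m i y = cotangentIncl m i y * cotangentIncl m 0 x := by
  obtain ⟨x, a, ha, rfl⟩ := x
  obtain ⟨y, b, hb, rfl⟩ := y
  refine (DirectSum.of_mul_of _ _).trans (Eq.trans ?_ (DirectSum.of_mul_of _ _).symm)
  refine congrArg (DirectSum.of (GrPiece m.toIdeal) (1 + 1)) ?_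
  refine (grMul_grMk _ a b).trans (Eq.trans ?_ (grMul_grMk _ b a).symm)
  exact congrArg (grMk m.toIdeal (1 + 1)) (Subtype.ext (even_commute 𝒜 ha _))

theorem cotangentIncl_odd_sq (x : cotangentPart m 1) :
    cotangentIncl m 1 x * cotangentIncl m 1 x = 0 := by
  obtain ⟨x, a, ha, rfl⟩ := x
  refine (DirectSum.of_mul_of _ _).trans ?_
  refine Eq.trans (congrArg (DirectSum.of (GrPiece m.toIdeal) (1 + 1)) ?_) (map_zero _)
  refine (grMul_grMk _ a a).trans ?_
  refine Eq.trans (congrArg (grMk m.toIdeal (1 + 1)) (Subtype.ext ?_)) (map_zero _)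
  exact SuperCommutative.odd_sq ha

theorem even_range_comm : ∀ a ∈ Set.range (cotangentIncl m 0), ∀ b ∈ Set.range (cotangentIncl m 0),
    a * b = b * a := by
  rintro _ ⟨x, rfl⟩ _ ⟨y, rfl⟩
  exact cotangentIncl_even_comm m 0 x y

/-- The subalgebra of `gr_𝔪(A)` generated by `(𝔪/𝔪²)₀`, which is commutative. -/
noncomputable def evenSubalgebra : Subalgebra (ResidueField m) (Gr m) :=
  Algebra.adjoin (ResidueField m) (Set.range (cotangentIncl m 0))

noncomputable instance evenSubalgebraCommRing : CommRing (evenSubalgebra m) where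
  __ := (evenSubalgebra m).toRing
  mul_comm := (Algebra.isMulCommutative_adjoin (ResidueField m) (even_range_comm m)).is_comm.comm

/-- The embedding of `(𝔪/𝔪²)₀` in the commutative subalgebra that it generates. -/
noncomputable def cotangentEven : cotangentPart m 0 →ₗ[ResidueField m] evenSubalgebra m :=
  (cotangentIncl m 0).codRestrict (Subalgebra.toSubmodule (evenSubalgebra m))
    (fun x => Algebra.subset_adjoin ⟨x, rfl⟩)

/-- The `K`-algebra map `S_K((𝔪/𝔪²)₀) → gr_𝔪(A)` induced by the embedding of `(𝔪/𝔪²)₀`; it takes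
values in the commutative subalgebra generated by `(𝔪/𝔪²)₀`. -/
noncomputable def kappaEven :
    SymmetricAlgebra (ResidueField m) (cotangentPart m 0) →ₐ[ResidueField m] Gr m :=
  (evenSubalgebra m).val.comp (SymmetricAlgebra.lift (cotangentEven m))

theorem kappaEven_ι (x : cotangentPart m 0) :
    kappaEven m (SymmetricAlgebra.ι _ _ x) = cotangentIncl m 0 x := by
  have h := SymmetricAlgebra.lift_ι_apply (cotangentEven m) x
  rw [kappaEven, AlgHom.comp_apply, h]
  rfl

/-- The `K`-algebra map `∧_K((𝔪/𝔪²)₁) → gr_𝔪(A)` induced by the embedding of `(𝔪/𝔪²)₁`. -/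
noncomputable def kappaOdd :
    ExteriorAlgebra (ResidueField m) (cotangentPart m 1) →ₐ[ResidueField m] Gr m :=
  ExteriorAlgebra.lift (ResidueField m) ⟨cotangentIncl m 1, cotangentIncl_odd_sq m⟩

theorem kappaOdd_ι (x : cotangentPart m 1) :
    kappaOdd m (ExteriorAlgebra.ι _ x) = cotangentIncl m 1 x :=
  ExteriorAlgebra.lift_ι_apply _ _ _ x

theorem kappa_commute (s : SymmetricAlgebra (ResidueField m) (cotangentPart m 0))
    (w : ExteriorAlgebra (ResidueField m) (cotangentPart m 1)) :
    Commute (kappaEven m s) (kappaOdd m w) := by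
  induction s using SymmetricAlgebra.induction with
  | algebraMap r => rw [AlgHom.commutes]; exact Algebra.commute_algebraMap_left _ _
  | mul a b ha hb => rw [map_mul]; exact ha.mul_left hb
  | add a b ha hb => rw [map_add]; exact ha.add_left hb
  | ι x =>
    rw [kappaEven_ι]
    induction w using ExteriorAlgebra.induction with
    | algebraMap r => rw [AlgHom.commutes]; exact Algebra.commute_algebraMap_right _ _
    | mul a b ha hb => rw [map_mul]; exact ha.mul_right hb
    | add a b ha hb => rw [map_add]; exact ha.add_right hb
    | ι y => rw [kappaOdd_ι]; exact cotangentIncl_even_comm m 1 x y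

/-- The graded `K`-superalgebra map
`κ_A : S_K((𝔪/𝔪²)₀) ⊗_K ∧_K((𝔪/𝔪²)₁) → gr_𝔪(A)` induced by the embedding `𝔪/𝔪² → gr_𝔪(A)`.
Since the first factor is purely even, the tensor product of superalgebras is the usual one. -/
noncomputable def kappa :
    SymmetricAlgebra (ResidueField m) (cotangentPart m 0) ⊗[ResidueField m]
      ExteriorAlgebra (ResidueField m) (cotangentPart m 1) →ₐ[ResidueField m] Gr m :=
  Algebra.TensorProduct.lift (kappaEven m) (kappaOdd m) (kappa_commute m)

end Kappa

end SuperRing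

/-!
The products of two odd elements generate an ideal `I = A₁² ∩ A₀` of `A₀` which lies in every prime
ideal. Let `x₁, …, x_r` and `θ₁, …, θ_q` lift bases of the two components of `𝔪/𝔪²`. By Nakayama's
lemma the maximal ideal of `A₀` is `(x) + I` and `A₁` is spanned by `θ`, so `A₁^q` is generated by
`θ₁ ⋯ θ_q` and `A₁^(q+1) = 0`. Hence `Kdim A₀ ≤ r`, odd parameters have length at most `q`, and
with `J = Ann(θ₁ ⋯ θ_q) ⊇ I` regularity of `A` means that `A₀/J` has dimension `r`; equivalently,
that `x` is quasi-regular modulo `J`.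

Multiplication by complementary products of the odd generators reduces the injectivity of `κ` to
multiples of the top exterior product, that is, to the statement that `F(x) θ₁ ⋯ θ_q ∈ 𝔪ⁿ⁺ᵠ⁺¹`
forces a form `F` of degree `n` to have its coefficients in `𝔪`. This implies that `x` is
quasi-regular modulo `J`. Conversely, if `A` is regular then `J = I`, and `I ∩ (x)ᵏ = I (x)ᵏ` by
quasi-regularity modulo `I`. The power `𝔪ⁿ` is the sum of the products `(x)ⁿ⁻ʲ A₁ʲ`, and this
equality moves an element of `A₁^q ∩ 𝔪ⁿ⁺ᵠ⁺¹` up the powers of `A₁`, one at a time, until it lies in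
`(x)ⁿ⁺¹ A₁^q`.
-/

namespace SuperRing

section QuasiRegular

open MvPolynomial

variable {S ι : Type*} [CommRing S]

/-- A family `x` is quasi-regular if every form of degree `n` whose value at `x` lies in
`(x) ^ (n + 1)` has all its coefficients in `(x)`, i.e. if the surjection from the polynomial ring
over `S ⧸ (x)` to the associated graded ring of `(x)` is bijective. -/
def IsQuasiRegular (x : ι → S) : Prop :=
  ∀ (n : ℕ) (F : MvPolynomial ι S), F.IsHomogeneous n →
    eval x F ∈ Ideal.span (Set.range x) ^ (n + 1) → ∀ α, F.coeff α ∈ Ideal.span (Set.range x)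

theorem eval_mem_span_pow {n : ℕ} {F : MvPolynomial ι S} (x : ι → S) (hF : F.IsHomogeneous n) :
    eval x F ∈ Ideal.span (Set.range x) ^ n :=
  (Ideal.mem_span_pow_iff_exists_isHomogeneous x _).2 ⟨F, hF, rfl⟩

theorem eval_mem_mul_span_pow {I : Ideal S} {n : ℕ} {F : MvPolynomial ι S} (x : ι → S)
    (hF : F.IsHomogeneous n) (hI : ∀ α, F.coeff α ∈ I) :
    eval x F ∈ I * Ideal.span (Set.range x) ^ n := by
  rw [F.as_sum, map_sum]
  refine Ideal.sum_mem _ fun α hα => ?_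
  rw [← mul_one (coeff α F), ← C_mul_monomial, map_mul, eval_C]
  have hdeg : α.degree = n := by
    by_contra h
    exact mem_support_iff.1 hα (hF.coeff_eq_zero h)
  exact Ideal.mul_mem_mul (hI α) (eval_mem_span_pow x (isHomogeneous_monomial 1 hdeg))

theorem coeff_mem_of_isHomogeneous_zero {I : Ideal S} {F : MvPolynomial ι S} {x : ι → S}
    (hF : F.IsHomogeneous 0) (hx : eval x F ∈ I) (α : ι →₀ ℕ) : F.coeff α ∈ I := by
  obtain ⟨c, rfl⟩ : ∃ c, F = C c :=
    ⟨_, totalDegree_eq_zero_iff_eq_C.1 ((totalDegree_zero_iff_isHomogeneous _).2 hF)⟩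
  rw [eval_C] at hx
  classical
  rw [coeff_C]
  split_ifs
  exacts [hx, I.zero_mem]

theorem span_range_comp {T : Type*} [CommRing T] (f : S →+* T) (x : ι → S) :
    Ideal.span (Set.range (f ∘ x)) = (Ideal.span (Set.range x)).map f := by
  rw [Ideal.map_span, ← Set.range_comp]

theorem exists_isHomogeneous_map_eq {T : Type*} [CommRing T] {f : S →+* T}
    (hf : Function.Surjective f) {n : ℕ} {F : MvPolynomial ι T} (hF : F.IsHomogeneous n) :
    ∃ G : MvPolynomial ι S, G.IsHomogeneous n ∧ map f G = F := by
  obtain ⟨G, rfl⟩ := map_surjective f hf F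
  refine ⟨homogeneousComponent n G, homogeneousComponent_isHomogeneous n G, ?_⟩
  ext α
  rw [coeff_map, coeff_homogeneousComponent]
  split_ifs with h
  · rw [coeff_map]
  · rw [map_zero, hF.coeff_eq_zero h]

theorem isQuasiRegular_mk_iff (I : Ideal S) (x : ι → S) :
    IsQuasiRegular (Ideal.Quotient.mk I ∘ x) ↔
      ∀ (n : ℕ) (F : MvPolynomial ι S), F.IsHomogeneous n →
        eval x F ∈ Ideal.span (Set.range x) ^ (n + 1) ⊔ I →
        ∀ α, F.coeff α ∈ Ideal.span (Set.range x) ⊔ I := by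
  constructor
  · intro h n F hF hx α
    rw [← Ideal.mem_quotient_iff_mem_sup] at hx ⊢
    rw [Ideal.map_pow, ← span_range_comp, map_eval] at hx
    simpa only [span_range_comp, coeff_map] using h n _ (hF.map _) hx α
  · intro h n F hF hx α
    obtain ⟨G, hG, rfl⟩ := exists_isHomogeneous_map_eq Ideal.Quotient.mk_surjective hF
    rw [← map_eval, span_range_comp, ← Ideal.map_pow, Ideal.mem_quotient_iff_mem_sup] at hx
    rw [span_range_comp, coeff_map, Ideal.mem_quotient_iff_mem_sup]
    exact h n G hG hx α

theorem IsQuasiRegular.of_mk {I : Ideal S} {x : ι → S}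
    (h : IsQuasiRegular (Ideal.Quotient.mk I ∘ x)) (hI : I ≤ Ideal.span (Set.range x)) :
    IsQuasiRegular x := by
  intro n F hF hx α
  have := (isQuasiRegular_mk_iff I x).1 h n F hF (Ideal.mem_sup_left hx) α
  rwa [sup_eq_left.2 hI] at this

theorem IsQuasiRegular.mem_span_pow_of_mul_mem {x : ι → S} (hx : IsQuasiRegular x) {i : ι} {b : S}
    {k : ℕ} (h : x i * b ∈ Ideal.span (Set.range x) ^ (k + 1)) :
    b ∈ Ideal.span (Set.range x) ^ k := by
  induction k with
  | zero => simp
  | succ k ih =>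
    obtain ⟨F, hF, rfl⟩ := (Ideal.mem_span_pow_iff_exists_isHomogeneous x _).1
      (ih (Ideal.pow_le_pow_right (Nat.le_succ _) h))
    have hcoeff := hx (1 + k) (X i * F) ((isHomogeneous_X S i).mul hF)
      (by rwa [map_mul, eval_X, add_comm 1 k])
    rw [pow_succ']
    refine eval_mem_mul_span_pow x hF fun α => ?_
    rw [← coeff_X_mul]
    exact hcoeff _

theorem iInf_sup_pow_eq_of_le_jacobson [IsNoetherianRing S] {I : Ideal S} (J : Ideal S)
    (hI : I ≤ (⊥ : Ideal S).jacobson) : ⨅ n : ℕ, J ⊔ I ^ n = J := by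
  refine le_antisymm (fun a ha => ?_) (le_iInf fun _ => le_sup_left)
  have hbot := Ideal.iInf_pow_smul_eq_bot_of_le_jacobson (M := S ⧸ J) I hI
  rw [← Ideal.Quotient.eq_zero_iff_mem, ← Submodule.mem_bot S, ← hbot, Submodule.mem_iInf]
  intro n
  obtain ⟨b, hb, c, hc, rfl⟩ := Submodule.mem_sup.1 ((Submodule.mem_iInf _).1 ha n)
  rw [map_add, Ideal.Quotient.eq_zero_iff_mem.2 hb, zero_add, ← mul_one (Ideal.Quotient.mk J c)]
  exact Submodule.smul_mem_smul hc (Submodule.mem_top (x := (1 : S ⧸ J)))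

theorem IsQuasiRegular.inf_pow_le_sup {I : Ideal S} {x : ι → S}
    (h : IsQuasiRegular (Ideal.Quotient.mk I ∘ x)) (k : ℕ) :
    I ⊓ Ideal.span (Set.range x) ^ k ≤
      I * Ideal.span (Set.range x) ^ k ⊔ I ⊓ Ideal.span (Set.range x) ^ (k + 1) := by
  intro a ha
  obtain ⟨haI, hak⟩ := Submodule.mem_inf.1 ha
  obtain ⟨F, hF, hFa⟩ := (Ideal.mem_span_pow_iff_exists_isHomogeneous x _).1 hak
  have hmem := eval_mem_mul_span_pow x hF
    ((isQuasiRegular_mk_iff I x).1 h k F hF (Ideal.mem_sup_right (by rwa [hFa])))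
  rw [hFa, Ideal.sup_mul, sup_comm, ← pow_succ'] at hmem
  rw [inf_comm I, ← sup_inf_assoc_of_le _ Ideal.mul_le_left]
  exact Submodule.mem_inf.2 ⟨hmem, haI⟩

theorem IsQuasiRegular.inf_pow_le_mul_pow [IsNoetherianRing S] {I : Ideal S} {x : ι → S}
    (h : IsQuasiRegular (Ideal.Quotient.mk I ∘ x))
    (hx : Ideal.span (Set.range x) ≤ (⊥ : Ideal S).jacobson) (k : ℕ) :
    I ⊓ Ideal.span (Set.range x) ^ k ≤ I * Ideal.span (Set.range x) ^ k := by
  set b := Ideal.span (Set.range x)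
  have iterate (n : ℕ) : I ⊓ b ^ k ≤ I * b ^ k ⊔ I ⊓ b ^ (k + n) := by
    induction n with
    | zero => exact le_sup_right
    | succ n ih =>
      refine ih.trans (sup_le le_sup_left ((h.inf_pow_le_sup _).trans (sup_le_sup_right ?_ _)))
      exact Ideal.mul_mono_right (Ideal.pow_le_pow_right (Nat.le_add_right _ _))
  rw [← iInf_sup_pow_eq_of_le_jacobson (I * b ^ k) hx]
  refine le_iInf fun n => (iterate n).trans (sup_le_sup_left ?_ _)
  exact inf_le_right.trans (Ideal.pow_le_pow_right (Nat.le_add_left n k))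

theorem IsQuasiRegular.le_of_le_sup [IsNoetherianRing S] {I J : Ideal S} {x : ι → S}
    (h : IsQuasiRegular (Ideal.Quotient.mk J ∘ x))
    (hx : Ideal.span (Set.range x) ≤ (⊥ : Ideal S).jacobson) (hIJ : I ≤ J)
    (hJ : J ≤ Ideal.span (Set.range x) ⊔ I) : J ≤ I := by
  refine Submodule.le_of_le_smul_of_le_jacobson_bot (IsNoetherian.noetherian J) hx ?_
  have hinf : J ⊓ Ideal.span (Set.range x) ≤ Ideal.span (Set.range x) * J := by
    simpa only [pow_one, mul_comm] using h.inf_pow_le_mul_pow hx 1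
  calc J = I ⊔ Ideal.span (Set.range x) ⊓ J := by
        rw [← sup_inf_assoc_of_le _ hIJ, sup_comm, inf_eq_right.2 hJ]
    _ ≤ I ⊔ Ideal.span (Set.range x) • J := sup_le_sup_left (by rwa [inf_comm]) I

end QuasiRegular

section Tail

open MvPolynomial

variable {S : Type*} [CommRing S] {r : ℕ}

theorem span_range_eq_sup_tail (x : Fin (r + 1) → S) :
    Ideal.span (Set.range x) =
      Ideal.span (Set.range (x ∘ Fin.succ)) ⊔ Ideal.span {x 0} := by
  rw [← Ideal.span_union, Set.union_singleton, ← Fin.range_cons]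
  congr 2
  exact (Fin.cons_self_tail x).symm

theorem span_range_mk_tail (x : Fin (r + 1) → S) :
    Ideal.span (Set.range (Ideal.Quotient.mk (Ideal.span {x 0}) ∘ x ∘ Fin.succ)) =
      (Ideal.span (Set.range x)).map (Ideal.Quotient.mk (Ideal.span {x 0})) := by
  rw [span_range_comp, span_range_eq_sup_tail x, Ideal.map_sup, Ideal.map_quotient_self, sup_bot_eq]

theorem exists_rename_succ_eq {F : MvPolynomial (Fin (r + 1)) S}
    (hF : ∀ α ∈ F.support, α 0 = 0) : ∃ H : MvPolynomial (Fin r) S, rename Fin.succ H = F := by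
  refine exists_rename_eq_of_vars_subset_range F _ (Fin.succ_injective r) fun i hi => ?_
  obtain ⟨α, hα, hiα⟩ := (mem_vars_iff_mem_support i).1 hi
  refine Fin.exists_succ_eq.2 ?_
  rintro rfl
  exact Finsupp.mem_support_iff.1 hiα (hF α hα)

theorem exists_eq_X_mul_add_rename {n : ℕ} {F : MvPolynomial (Fin (r + 1)) S}
    (hF : F.IsHomogeneous (n + 1)) :
    ∃ (G : MvPolynomial (Fin (r + 1)) S) (H : MvPolynomial (Fin r) S),
      G.IsHomogeneous n ∧ H.IsHomogeneous (n + 1) ∧ F = X 0 * G + rename Fin.succ H := by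
  set e : Fin (r + 1) →₀ ℕ := Finsupp.single 0 1
  have not_le {α} (hα : coeff α (F.modMonomial e) ≠ 0) : ¬ e ≤ α :=
    fun h => hα (coeff_modMonomial_of_le F h)
  obtain ⟨H, hH⟩ := exists_rename_succ_eq (F := F.modMonomial e) fun α hα => by
    simpa [e] using not_le (mem_support_iff.1 hα)
  refine ⟨F.divMonomial e, H, fun α hα => ?_, ?_, ?_⟩
  · rw [coeff_divMonomial] at hα
    have hdeg := hF hα
    simp only [map_add, e, Finsupp.weight_single, Pi.one_apply, smul_eq_mul, mul_one] at hdeg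
    omega
  · rw [← IsHomogeneous.rename_isHomogeneous_iff (Fin.succ_injective r), hH]
    intro α hα
    have h := not_le hα
    rw [coeff_modMonomial_of_not_le F h] at hα
    exact hF hα
  · rw [hH, divMonomial_add_modMonomial_single]

theorem IsQuasiRegular.tail {x : Fin (r + 1) → S} (hx : IsQuasiRegular x) :
    IsQuasiRegular (Ideal.Quotient.mk (Ideal.span {x 0}) ∘ x ∘ Fin.succ) := by
  rw [isQuasiRegular_mk_iff]
  intro n F hF hev α
  rw [← span_range_eq_sup_tail x]
  obtain ⟨g, hg, c, hc, hgc⟩ := Submodule.mem_sup.1 hev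
  obtain ⟨b, rfl⟩ := Ideal.mem_span_singleton.1 hc
  rw [← eval_rename] at hgc
  have htail : Ideal.span (Set.range (x ∘ Fin.succ)) ≤ Ideal.span (Set.range x) :=
    span_range_eq_sup_tail x ▸ le_sup_left
  have hg' := Ideal.pow_right_mono htail (n + 1) hg
  have hF' : (rename Fin.succ F).IsHomogeneous n := hF.rename_isHomogeneous
  rw [← coeff_rename_mapDomain _ (Fin.succ_injective r)]
  cases n with
  | zero =>
    rw [zero_add, pow_one] at hg'
    refine coeff_mem_of_isHomogeneous_zero hF' (x := x) ?_ _
    rw [← hgc]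
    exact add_mem hg' (Ideal.mul_mem_right _ _ (Ideal.subset_span ⟨0, rfl⟩))
  | succ n =>
    have hb : x 0 * b ∈ Ideal.span (Set.range x) ^ (n + 1) := by
      rw [← add_sub_cancel_left g (x 0 * b), hgc]
      exact sub_mem (eval_mem_span_pow x hF') (Ideal.pow_le_pow_right (Nat.le_succ _) hg')
    obtain ⟨B, hB, rfl⟩ := (Ideal.mem_span_pow_iff_exists_isHomogeneous x _).1
      (hx.mem_span_pow_of_mul_mem hb)
    have hXB : (X 0 * B).IsHomogeneous (n + 1) := add_comm 1 n ▸ (isHomogeneous_X S 0).mul hB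
    have hcoeff := hx _ _ (hF'.sub hXB)
      (by rwa [map_sub, map_mul, eval_X, ← hgc, add_sub_cancel_right]) (α.mapDomain Fin.succ)
    have h0 : (0 : Fin (r + 1)) ∉ (α.mapDomain Fin.succ).support := by
      rw [Finsupp.notMem_support_iff]
      exact Finsupp.mapDomain_of_notMem_range _ _ (by simp)
    rwa [coeff_sub, coeff_X_mul', if_neg h0, sub_zero] at hcoeff

theorem sup_pow_succ_le (I J : Ideal S) (n : ℕ) :
    (I ⊔ J) ^ (n + 1) ≤ J * (I ⊔ J) ^ n ⊔ I ^ (n + 1) := by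
  induction n with
  | zero => simp only [zero_add, pow_zero, pow_one, mul_one, sup_comm, le_refl]
  | succ n ih =>
    calc (I ⊔ J) ^ (n + 1 + 1)
        = I * (I ⊔ J) ^ (n + 1) ⊔ J * (I ⊔ J) ^ (n + 1) := by rw [pow_succ', Ideal.sup_mul]
      _ ≤ I * (J * (I ⊔ J) ^ n ⊔ I ^ (n + 1)) ⊔ J * (I ⊔ J) ^ (n + 1) :=
        sup_le_sup_right (Ideal.mul_mono_right ih) _
      _ = (J * (I * (I ⊔ J) ^ n) ⊔ I ^ (n + 1 + 1)) ⊔ J * (I ⊔ J) ^ (n + 1) := by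
        rw [Ideal.mul_sup, ← pow_succ' I, mul_left_comm]
      _ ≤ J * (I ⊔ J) ^ (n + 1) ⊔ I ^ (n + 1 + 1) := by
        rw [sup_right_comm, pow_succ' (I ⊔ J) n]
        exact sup_le_sup_right
          (sup_le (Ideal.mul_mono_right (Ideal.mul_mono_left le_sup_left)) le_rfl) _

theorem mem_span_pow_of_zero_mul_mem [IsNoetherianRing S] {x : Fin (r + 1) → S}
    (hx0 : x 0 ∈ nonZeroDivisors S)
    (htail : IsQuasiRegular (Ideal.Quotient.mk (Ideal.span {x 0}) ∘ x ∘ Fin.succ))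
    (hj : Ideal.span (Set.range x) ≤ (⊥ : Ideal S).jacobson) {n : ℕ} {a : S}
    (ha : x 0 * a ∈ Ideal.span (Set.range x) ^ (n + 1)) : a ∈ Ideal.span (Set.range x) ^ n := by
  set m := Ideal.span (Set.range x)
  set b := Ideal.span (Set.range (x ∘ Fin.succ))
  have hm : m = b ⊔ Ideal.span {x 0} := span_range_eq_sup_tail x
  have hbm : b ≤ m := hm ▸ le_sup_left
  obtain ⟨c, hc, d, hd, hcd⟩ := Submodule.mem_sup.1
    (show x 0 * a ∈ Ideal.span {x 0} * m ^ n ⊔ b ^ (n + 1) from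
      hm ▸ sup_pow_succ_le b (Ideal.span {x 0}) n (hm ▸ ha))
  have hd0 : d ∈ Ideal.span {x 0} := by
    rw [← add_sub_cancel_left c d, hcd]
    exact sub_mem (Ideal.mul_mem_right _ _ (Ideal.mem_span_singleton_self _))
      (Ideal.mul_le_left hc)
  have hdm : d ∈ Ideal.span {x 0} * m ^ n :=
    Ideal.mul_mono_right ((Ideal.pow_right_mono hbm _).trans (Ideal.pow_le_pow_right n.le_succ))
      (htail.inf_pow_le_mul_pow (hbm.trans hj) (n + 1) ⟨hd0, hd⟩)
  obtain ⟨a', ha', haa'⟩ := Ideal.mem_span_singleton_mul.1 (hcd ▸ add_mem hc hdm)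
  rwa [← (mul_cancel_left_mem_nonZeroDivisors hx0).1 haa']

theorem isQuasiRegular_of_tail [IsNoetherianRing S] {x : Fin (r + 1) → S}
    (hx0 : x 0 ∈ nonZeroDivisors S)
    (htail : IsQuasiRegular (Ideal.Quotient.mk (Ideal.span {x 0}) ∘ x ∘ Fin.succ))
    (hj : Ideal.span (Set.range x) ≤ (⊥ : Ideal S).jacobson) : IsQuasiRegular x := by
  intro n
  induction n with
  | zero =>
    intro F hF hev
    rw [zero_add, pow_one] at hev
    exact coeff_mem_of_isHomogeneous_zero hF hev
  | succ n ih =>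
    intro F hF hev
    obtain ⟨G, H, hG, hH, rfl⟩ := exists_eq_X_mul_add_rename hF
    rw [map_add, map_mul, eval_X, eval_rename] at hev
    have hm := span_range_eq_sup_tail x
    have hHcoeff (α) : H.coeff α ∈ Ideal.span (Set.range x) := by
      rw [hm]
      refine (isQuasiRegular_mk_iff _ _).1 htail _ H hH ?_ α
      have hle := (sup_pow_succ_le (Ideal.span (Set.range (x ∘ Fin.succ))) (Ideal.span {x 0})
        (n + 1)).trans (sup_le_sup_right Ideal.mul_le_left _)
      rw [sup_comm]
      exact (Submodule.add_mem_iff_right _ (Ideal.mem_sup_left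
        (Ideal.mul_mem_right _ _ (Ideal.mem_span_singleton_self _)))).1 (hle (hm ▸ hev))
    have hHeval : eval (x ∘ Fin.succ) H ∈ Ideal.span (Set.range x) ^ (n + 1 + 1) := by
      rw [pow_succ']
      exact Ideal.mul_mono_right (Ideal.pow_right_mono (hm ▸ le_sup_left) _)
        (eval_mem_mul_span_pow _ hH hHcoeff)
    have hGcoeff := ih G hG (mem_span_pow_of_zero_mul_mem hx0 htail hj
      ((Submodule.add_mem_iff_left _ hHeval).1 hev))
    rw [← mem_map_C_iff] at hGcoeff ⊢
    refine add_mem (Ideal.mul_mem_left _ _ hGcoeff) (mem_map_C_iff.2 fun α => ?_)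
    by_cases h : ∃ β : Fin r →₀ ℕ, β.mapDomain Fin.succ = α
    · obtain ⟨β, rfl⟩ := h
      rw [coeff_rename_mapDomain _ (Fin.succ_injective r)]
      exact hHcoeff β
    · rw [coeff_rename_eq_zero _ _ _ fun β hβ => absurd ⟨β, hβ⟩ h]
      exact zero_mem _

end Tail

section Dimension

open IsLocalRing

theorem isLocalRing_quotient {S : Type*} [CommRing S] [IsLocalRing S] {I : Ideal S}
    (hI : I ≠ ⊤) : IsLocalRing (S ⧸ I) :=
  have : Nontrivial (S ⧸ I) := Ideal.Quotient.nontrivial_iff.2 hI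
  .of_surjective' _ Ideal.Quotient.mk_surjective

theorem ringKrullDim_le_of_maximalIdeal_eq_span {S : Type*} [CommRing S] [IsLocalRing S]
    [IsNoetherianRing S] {r : ℕ} {x : Fin r → S}
    (hx : Ideal.span (Set.range x) = maximalIdeal S) : ringKrullDim S ≤ r := by
  refine (ringKrullDim_le_spanFinrank_maximalIdeal S).trans ?_
  rw [← hx]
  have h := (Submodule.spanFinrank_span_le_ncard_of_finite (R := S) (Set.finite_range x)).trans
    (Set.image_univ (f := x) ▸ Set.ncard_image_le Set.finite_univ)
  rw [Set.ncard_univ, Nat.card_eq_fintype_card, Fintype.card_fin] at h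
  exact_mod_cast h

theorem IsQuasiRegular.mem_nonZeroDivisors {S ι : Type*} [CommRing S] [IsNoetherianRing S]
    {x : ι → S} (hx : IsQuasiRegular x)
    (hj : Ideal.span (Set.range x) ≤ (⊥ : Ideal S).jacobson) (i : ι) :
    x i ∈ nonZeroDivisors S := by
  refine mem_nonZeroDivisors_iff_right.2 fun b hb => (Submodule.mem_bot S).1 ?_
  rw [← iInf_sup_pow_eq_of_le_jacobson ⊥ hj, Submodule.mem_iInf]
  refine fun n => Ideal.mem_sup_right (hx.mem_span_pow_of_mul_mem (i := i) ?_)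
  rw [mul_comm, hb]
  exact zero_mem _

theorem IsQuasiRegular.le_ringKrullDim {r : ℕ} {S : Type*} [CommRing S] [IsLocalRing S]
    [IsNoetherianRing S] {x : Fin r → S} (hx : IsQuasiRegular x)
    (hne : Ideal.span (Set.range x) ≠ ⊤) : (r : WithBot ℕ∞) ≤ ringKrullDim S := by
  induction r generalizing S with
  | zero => exact_mod_cast ringKrullDim_nonneg_of_nontrivial
  | succ r ih =>
    have hx0 : Ideal.span {x 0} ≤ Ideal.span (Set.range x) := Ideal.span_mono (by simp)
    have := isLocalRing_quotient (ne_top_of_le_ne_top hne hx0)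
    have hdim := ih hx.tail (by
      rwa [span_range_mk_tail, Ne, Ideal.eq_top_iff_one, ← map_one (Ideal.Quotient.mk _),
        Ideal.mem_quotient_iff_mem_sup, sup_eq_left.2 hx0, ← Ideal.eq_top_iff_one])
    have hreg := hx.mem_nonZeroDivisors
      ((le_maximalIdeal hne).trans (maximalIdeal_le_jacobson ⊥)) 0
    rw [Nat.cast_add, Nat.cast_one]
    exact (add_le_add_left hdim 1).trans (ringKrullDim_quotient_succ_le_of_nonZeroDivisor hreg)

theorem exists_isPrime_le_ringKrullDim_quotient {S : Type*} [CommRing S] {r : ℕ}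
    (h : (r : WithBot ℕ∞) ≤ ringKrullDim S) :
    ∃ p : Ideal S, p.IsPrime ∧ (r : WithBot ℕ∞) ≤ ringKrullDim (S ⧸ p) := by
  obtain ⟨l, hl⟩ := Order.le_krullDim_iff.1 h
  refine ⟨l.head.asIdeal, l.head.isPrime, ?_⟩
  rw [ringKrullDim_quotient]
  have hIci : PrimeSpectrum.zeroLocus (R := S) l.head.asIdeal = Set.Ici l.head := rfl
  rw [hIci, ← Order.coheight_eq_krullDim_Ici, ← hl]
  exact_mod_cast Order.length_le_coheight le_rfl

theorem map_mk_maximalIdeal {S : Type*} [CommRing S] [IsLocalRing S] (I : Ideal S)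
    [IsLocalRing (S ⧸ I)] :
    (maximalIdeal S).map (Ideal.Quotient.mk I) = maximalIdeal (S ⧸ I) :=
  map_maximalIdeal_of_surjective _ Ideal.Quotient.mk_surjective

theorem isQuasiRegular_of_le_ringKrullDim {r : ℕ} {S : Type*} [CommRing S] [IsLocalRing S]
    [IsNoetherianRing S] {x : Fin r → S} (hdim : (r : WithBot ℕ∞) ≤ ringKrullDim S)
    (hm : Ideal.span (Set.range x) = maximalIdeal S) : IsQuasiRegular x := by
  induction r generalizing S with
  | zero =>
    intro n F _ hev α
    have := Ideal.pow_le_self n.succ_ne_zero hev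
    rw [MvPolynomial.eq_C_of_isEmpty F, MvPolynomial.eval_C] at this
    rwa [Subsingleton.elim α 0]
  | succ r ih =>
    -- Passing to a prime quotient of dimension at least `r + 1` makes `x 0` a nonzerodivisor.
    obtain ⟨p, hp, hdimp⟩ := exists_isPrime_le_ringKrullDim_quotient hdim
    refine IsQuasiRegular.of_mk (I := p) ?_ (hm ▸ le_maximalIdeal hp.ne_top)
    have := isLocalRing_quotient hp.ne_top
    have hmy : Ideal.span (Set.range (Ideal.Quotient.mk p ∘ x)) = maximalIdeal (S ⧸ p) := by
      rw [span_range_comp, hm, map_mk_maximalIdeal]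
    generalize Ideal.Quotient.mk p ∘ x = y at *
    have hy0 : y 0 ∈ nonZeroDivisors (S ⧸ p) := by
      refine mem_nonZeroDivisors_of_ne_zero fun h0 => ?_
      have htail := span_range_eq_sup_tail y
      rw [h0, Ideal.span_singleton_zero, sup_bot_eq, hmy] at htail
      have := hdimp.trans (ringKrullDim_le_of_maximalIdeal_eq_span htail.symm)
      norm_cast at this
      omega
    have hy0m : y 0 ∈ maximalIdeal (S ⧸ p) := hmy ▸ Ideal.subset_span ⟨0, rfl⟩
    have := isLocalRing_quotient (ne_top_of_le_ne_top Ideal.IsPrime.ne_top'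
      ((Ideal.span_singleton_le_iff_mem _).2 hy0m))
    refine isQuasiRegular_of_tail hy0 (ih ?_ ?_) (hmy ▸ maximalIdeal_le_jacobson ⊥)
    · rw [← ringKrullDim_quotient_span_singleton_succ_eq_ringKrullDim_of_mem_nonZeroDivisors
        hy0 hy0m, Nat.cast_add, Nat.cast_one] at hdimp
      exact ENat.WithBot.add_le_add_one_right_iff.1 hdimp
    · rw [span_range_mk_tail, hmy, map_mk_maximalIdeal]

end Dimension

section Anticommuting

variable {B : Type*} [Ring B] {ι : Type*}

/-- A family of pairwise anticommuting elements with zero squares. -/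
structure IsAnticommuting (θ : ι → B) : Prop where
  anti : ∀ i j, θ i * θ j = -(θ j * θ i)
  sq : ∀ i, θ i * θ i = 0

/-- The product of the `θ i`, `i ∈ s`, in an unspecified order. For an anticommuting family `θ`
it is independent of the order up to sign. -/
noncomputable def finsetProd (θ : ι → B) (s : Finset ι) : B := (s.toList.map θ).prod

theorem IsAnticommuting.map {C : Type*} [Ring C] {θ : ι → B} (h : IsAnticommuting θ)
    (f : B →+* C) : IsAnticommuting (f ∘ θ) where
  anti i j := by rw [Function.comp_apply, Function.comp_apply, ← map_mul, h.anti, map_neg, map_mul]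
  sq i := by rw [Function.comp_apply, ← map_mul, h.sq, map_zero]

theorem map_finsetProd {C : Type*} [Ring C] (f : B →+* C) (θ : ι → B) (s : Finset ι) :
    f (finsetProd θ s) = finsetProd (f ∘ θ) s := by
  rw [finsetProd, finsetProd, map_list_prod, List.map_map]

theorem finsetProd_mem_span_pow {R : Type*} [CommRing R] [Algebra R B] (θ : ι → B)
    (s : Finset ι) : finsetProd θ s ∈ Submodule.span R (Set.range θ) ^ s.card := by
  rw [← Finset.length_toList, finsetProd]
  induction s.toList with
  | nil => exact Submodule.one_le.1 le_rfl
  | cons i l ih =>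
    rw [List.map_cons, List.prod_cons, List.length_cons, pow_succ']
    exact Submodule.mul_mem_mul (Submodule.subset_span ⟨i, rfl⟩) ih

namespace IsAnticommuting

variable {θ : ι → B}

theorem prod_perm (h : IsAnticommuting θ) {l l' : List ι} (p : l.Perm l') :
    (l.map θ).prod = (l'.map θ).prod ∨ (l.map θ).prod = -(l'.map θ).prod := by
  induction p with
  | nil => exact Or.inl rfl
  | cons i _ ih =>
    simp only [List.map_cons, List.prod_cons]
    rcases ih with e | e <;> simp [e]
  | swap i j l =>
    simp only [List.map_cons, List.prod_cons]
    exact Or.inr (by rw [← mul_assoc, h.anti, neg_mul, mul_assoc])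
  | trans _ _ ih ih' => rcases ih with e | e <;> rcases ih' with e' | e' <;> simp [e, e']

theorem prod_eq_zero_of_not_nodup (h : IsAnticommuting θ) {l : List ι} (hl : ¬ l.Nodup) :
    (l.map θ).prod = 0 := by
  obtain ⟨i, hi⟩ : ∃ i, List.Sublist [i, i] l := by simpa [List.nodup_iff_sublist] using hl
  obtain ⟨t, ht⟩ := hi.exists_perm_append
  have hzero : (([i, i] ++ t).map θ).prod = 0 := by simp [← mul_assoc, h.sq]
  rcases h.prod_perm ht with e | e <;> rw [e, hzero]
  exact neg_zero

theorem prod_eq_finsetProd (h : IsAnticommuting θ) [DecidableEq ι] {l : List ι} (hl : l.Nodup) :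
    (l.map θ).prod = finsetProd θ l.toFinset ∨ (l.map θ).prod = -finsetProd θ l.toFinset :=
  h.prod_perm (List.toFinset_toList hl).symm

theorem prod_ofFn_eq {q : ℕ} {θ : Fin q → B} (h : IsAnticommuting θ) :
    (List.ofFn θ).prod = finsetProd θ Finset.univ ∨
      (List.ofFn θ).prod = -finsetProd θ Finset.univ := by
  have := h.prod_eq_finsetProd (List.nodup_finRange q)
  rwa [List.toFinset_finRange, ← List.ofFn_eq_map] at this

theorem finsetProd_mul_eq_zero (h : IsAnticommuting θ) {s t : Finset ι} (hst : ¬ Disjoint s t) :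
    finsetProd θ s * finsetProd θ t = 0 := by
  rw [finsetProd, finsetProd, ← List.prod_append, ← List.map_append]
  refine h.prod_eq_zero_of_not_nodup fun hn => hst (Finset.disjoint_left.2 fun i hi hi' => ?_)
  exact List.disjoint_of_nodup_append hn (Finset.mem_toList.2 hi) (Finset.mem_toList.2 hi')

theorem finsetProd_mul_of_disjoint (h : IsAnticommuting θ) [DecidableEq ι]
    {s t : Finset ι} (hst : Disjoint s t) :
    finsetProd θ s * finsetProd θ t = finsetProd θ (s ∪ t) ∨
      finsetProd θ s * finsetProd θ t = -finsetProd θ (s ∪ t) := by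
  have hn : (s.toList ++ t.toList).Nodup := List.Nodup.append s.nodup_toList t.nodup_toList
    fun i hi hi' => Finset.disjoint_left.1 hst (Finset.mem_toList.1 hi) (Finset.mem_toList.1 hi')
  have := h.prod_eq_finsetProd hn
  rwa [List.map_append, List.prod_append, List.toFinset_append, Finset.toList_toFinset,
    Finset.toList_toFinset] at this

section Span

variable {R : Type*} [CommRing R] [Algebra R B]

theorem prod_mem_span (h : IsAnticommuting θ) (l : List ι) :
    (l.map θ).prod ∈ Submodule.span R (finsetProd θ '' {s | s.card = l.length}) := by
  classical
  by_cases hl : l.Nodup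
  · have : finsetProd θ l.toFinset ∈ Submodule.span R (finsetProd θ '' {s | s.card = l.length}) :=
      Submodule.subset_span ⟨_, List.toFinset_card_of_nodup hl, rfl⟩
    rcases h.prod_eq_finsetProd hl with e | e <;> rw [e]
    exacts [this, neg_mem this]
  · rw [h.prod_eq_zero_of_not_nodup hl]
    exact zero_mem _

theorem span_pow_eq (h : IsAnticommuting θ) (k : ℕ) :
    Submodule.span R (Set.range θ) ^ k =
      Submodule.span R (finsetProd θ '' {s | s.card = k}) := by
  apply le_antisymm
  · rw [Submodule.span_pow, Submodule.span_le]
    intro a ha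
    obtain ⟨f, rfl⟩ := Set.mem_pow.1 ha
    choose g hg using fun i => (f i).2
    have := h.prod_mem_span (R := R) (List.ofFn g)
    rwa [List.length_ofFn, List.map_ofFn, show θ ∘ g = fun i => (f i : B) from funext hg] at this
  · rw [Submodule.span_le]
    rintro _ ⟨s, rfl, rfl⟩
    exact finsetProd_mem_span_pow θ s

theorem span_pow_eq_bot [Fintype ι] (h : IsAnticommuting θ) {k : ℕ} (hk : Fintype.card ι < k) :
    Submodule.span R (Set.range θ) ^ k = ⊥ := by
  rw [h.span_pow_eq, Submodule.span_eq_bot]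
  rintro _ ⟨s, rfl, rfl⟩
  exact absurd s.card_le_univ hk.not_ge

theorem span_pow_card [Fintype ι] (h : IsAnticommuting θ) :
    Submodule.span R (Set.range θ) ^ Fintype.card ι =
      Submodule.span R {finsetProd θ Finset.univ} := by
  simp only [h.span_pow_eq, Finset.card_eq_iff_eq_univ, Set.ofPred_eq_eq_singleton,
    Set.image_singleton]

end Span

section Top

variable [Fintype ι] [DecidableEq ι]

theorem finsetProd_mul_compl (h : IsAnticommuting θ) (s : Finset ι) :
    finsetProd θ s * finsetProd θ sᶜ = finsetProd θ Finset.univ ∨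
      finsetProd θ s * finsetProd θ sᶜ = -finsetProd θ Finset.univ := by
  simpa only [Finset.union_compl] using h.finsetProd_mul_of_disjoint (disjoint_compl_right (a := s))

theorem finsetProd_mul_compl_of_ne (h : IsAnticommuting θ) {s t : Finset ι}
    (hc : s.card ≤ t.card) (hne : t ≠ s) : finsetProd θ t * finsetProd θ sᶜ = 0 :=
  h.finsetProd_mul_eq_zero fun hd =>
    hne (Finset.eq_of_subset_of_card_le (disjoint_compl_right_iff.1 hd) hc)

variable {R : Type*} [CommRing R] [Algebra R B]

theorem mem_smul_of_mul_eq_zero (h : IsAnticommuting θ) {b c : Ideal R}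
    (hb : ∀ g ∈ b, g • finsetProd θ Finset.univ = 0 → g ∈ c) {k : ℕ} {a : B}
    (ha : a ∈ b • Submodule.span R (Set.range θ) ^ k)
    (ha' : ∀ s : Finset ι, s.card = k → a * finsetProd θ sᶜ = 0) :
    a ∈ c • Submodule.span R (Set.range θ) ^ k := by
  rw [h.span_pow_eq, Submodule.mem_ideal_smul_span_iff_exists_sum'] at ha ⊢
  obtain ⟨g, hg, rfl⟩ := ha
  refine ⟨g, fun s => hb _ (hg s) ?_, rfl⟩
  have hzero := ha' s.1 s.2
  rw [Finsupp.sum_fintype _ _ (by simp), Finset.sum_mul, Fintype.sum_eq_single s,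
    smul_mul_assoc] at hzero
  · rcases h.finsetProd_mul_compl s.1 with e | e <;> rw [e] at hzero
    · exact hzero
    · rwa [smul_neg, neg_eq_zero] at hzero
  · intro t hts
    rw [smul_mul_assoc, h.finsetProd_mul_compl_of_ne (s.2.trans t.2.symm).le
      (Subtype.coe_ne_coe.2 hts), smul_zero]

end Top

variable {R : Type*} [CommRing R] [Algebra R B]

-- Multiplying by `finsetProd θ sᶜ` isolates the coefficient of `finsetProd θ s`, for `s` of least
-- cardinality in the support.
theorem injective_of_top [Fintype ι] (h : IsAnticommuting θ) {G : Type*} [Ring G] (φ : B →+* G)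
    (hspan : Submodule.span R (Set.range (finsetProd θ)) = ⊤)
    (htop : ∀ f : R, φ (f • finsetProd θ Finset.univ) = 0 → f = 0) : Function.Injective φ := by
  classical
  rw [injective_iff_map_eq_zero]
  intro z hz
  obtain ⟨f, rfl⟩ := (Submodule.mem_span_range_iff_exists_fun R).1
    (hspan ▸ Submodule.mem_top : z ∈ Submodule.span R (Set.range (finsetProd θ)))
  suffices hf : ∀ (k : ℕ) (s : Finset ι), s.card = k → f s = 0 from
    Finset.sum_eq_zero fun s _ => by rw [hf _ s rfl, zero_smul]
  intro k
  induction k using Nat.strong_induction_on with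
  | _ k ih =>
    rintro s rfl
    have hcoeff : (∑ t, f t • finsetProd θ t) * finsetProd θ sᶜ =
        f s • (finsetProd θ s * finsetProd θ sᶜ) := by
      rw [Finset.sum_mul, Finset.sum_eq_single s, smul_mul_assoc]
      · intro t _ hts
        by_cases hc : t.card < s.card
        · rw [ih _ hc t rfl, zero_smul, zero_mul]
        · rw [smul_mul_assoc, h.finsetProd_mul_compl_of_ne (not_lt.1 hc) hts, smul_zero]
      · simp
    have hzero : φ (f s • (finsetProd θ s * finsetProd θ sᶜ)) = 0 := by
      rw [← hcoeff, map_mul, hz, zero_mul]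
    refine htop _ ?_
    rcases h.finsetProd_mul_compl s with e | e <;> rw [e] at hzero
    · exact hzero
    · rwa [smul_neg, map_neg, neg_eq_zero] at hzero

end IsAnticommuting

end Anticommuting

section MixedPow

variable {R B : Type*} [CommRing R] [Ring B] [Algebra R B]

/-- The sum over `j` of the `a ^ (n - j) • N ^ j`, with truncated subtraction: the filtration
generated by giving weight one both to `a` and to `N`. -/
def mixedPow (a : Ideal R) (N : Submodule R B) (n : ℕ) : Submodule R B :=
  ⨆ j : ℕ, a ^ (n - j) • N ^ j

variable (a : Ideal R) (N : Submodule R B)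

theorem pow_smul_pow_le_mixedPow {n i j : ℕ} (hij : n ≤ i + j) :
    a ^ i • N ^ j ≤ mixedPow a N n :=
  le_iSup_of_le j (Submodule.smul_mono_left (Ideal.pow_le_pow_right (by omega)))

theorem mixedPow_succ_le (n : ℕ) : mixedPow a N (n + 1) ≤ mixedPow a N n :=
  iSup_le fun _ => pow_smul_pow_le_mixedPow a N (by omega)

theorem smul_mixedPow_le (n : ℕ) : a • mixedPow a N n ≤ mixedPow a N (n + 1) := by
  rw [mixedPow, Submodule.smul_iSup]
  refine iSup_le fun j => ?_
  rw [← Submodule.mul_smul, ← pow_succ']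
  exact pow_smul_pow_le_mixedPow a N (by omega)

theorem mul_mixedPow_le (n : ℕ) : N * mixedPow a N n ≤ mixedPow a N (n + 1) := by
  rw [mixedPow, Submodule.mul_iSup]
  refine iSup_le fun j => ?_
  rw [mul_smul_comm, ← pow_succ']
  exact pow_smul_pow_le_mixedPow a N (by omega)

theorem mixedPow_zero_eq_top (hN : 1 ⊔ N = ⊤) : mixedPow a N 0 = ⊤ := by
  rw [eq_top_iff, ← hN]
  refine sup_le ?_ ?_
  · simpa using pow_smul_pow_le_mixedPow a N (n := 0) (i := 0) (j := 0) le_rfl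
  · simpa using pow_smul_pow_le_mixedPow a N (n := 0) (i := 0) (j := 1) (Nat.zero_le _)

theorem mixedPow_mul_pow_le (n k : ℕ) :
    mixedPow a N n * N ^ k ≤ a ^ n • N ^ k ⊔ mixedPow a N (n - 1) * N ^ (k + 1) := by
  rw [mixedPow, Submodule.iSup_mul]
  refine iSup_le fun j => ?_
  rw [smul_mul_assoc, ← pow_add]
  cases j with
  | zero => simp only [Nat.sub_zero, zero_add, le_sup_left]
  | succ j =>
    refine le_sup_of_le_right ?_
    rw [show j + 1 + k = j + (k + 1) by ring, pow_add N, ← smul_mul_assoc]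
    exact mul_le_mul' (pow_smul_pow_le_mixedPow a N (by omega)) le_rfl

namespace IsAnticommuting

variable {ι : Type*} [Fintype ι] {θ : ι → B} (h : IsAnticommuting θ)
include h

theorem mem_mixedPow_mul_pow_succ {I a : Ideal R}
    (hI : ∀ n, ∀ g ∈ a ^ n, g • finsetProd θ Finset.univ = 0 → g ∈ a ^ n * I)
    (hI2 : I • (1 : Submodule R B) ≤ Submodule.span R (Set.range θ) ^ 2) {n k : ℕ} {z : B}
    (hk : k < Fintype.card ι) (hz : z ∈ Submodule.span R (Set.range θ) ^ Fintype.card ι)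
    (hzk : z ∈ mixedPow a (Submodule.span R (Set.range θ)) n *
      Submodule.span R (Set.range θ) ^ k) :
    z ∈ mixedPow a (Submodule.span R (Set.range θ)) (n - 1) *
      Submodule.span R (Set.range θ) ^ (k + 1) := by
  classical
  have hbot {l : ℕ} (hl : Fintype.card ι < l) := h.span_pow_eq_bot (R := R) hl
  have hcompl (s : Finset ι) := finsetProd_mem_span_pow (R := R) θ sᶜ
  simp only [Finset.card_compl] at hcompl
  set N := Submodule.span R (Set.range θ)
  obtain ⟨y, hy, w, hw, rfl⟩ := Submodule.mem_sup.1 (mixedPow_mul_pow_le a N n k hzk)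
  refine add_mem ?_ hw
  have hy' : y ∈ (a ^ n * I) • N ^ k := by
    refine h.mem_smul_of_mul_eq_zero (hI n) hy fun s hs => ?_
    have hyw : (y + w) * finsetProd θ sᶜ = 0 := by
      have hmul := Submodule.mul_mem_mul hz (hcompl s)
      rwa [← pow_add, hbot (by omega), Submodule.mem_bot] at hmul
    have hw0 : w * finsetProd θ sᶜ = 0 := by
      have hmul := Submodule.mul_mem_mul hw (hcompl s)
      rwa [mul_assoc, ← pow_add, hbot (by omega), Submodule.mul_bot, Submodule.mem_bot] at hmul
    rwa [add_mul, hw0, add_zero] at hyw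
  have hle : (a ^ n * I) • N ^ k ≤ mixedPow a N (n - 1) * N ^ (k + 1) :=
    calc (a ^ n * I) • N ^ k = a ^ n • ((I • 1) * N ^ k) := by
          rw [smul_mul_assoc, one_mul, Submodule.mul_smul]
      _ ≤ a ^ n • (N ^ 2 * N ^ k) := Submodule.smul_mono le_rfl (mul_le_mul' hI2 le_rfl)
      _ = (a ^ n • N ^ 1) * N ^ (k + 1) := by
        rw [smul_mul_assoc, ← pow_add, ← pow_add, show 1 + (k + 1) = 2 + k by ring]
      _ ≤ _ := mul_le_mul' (pow_smul_pow_le_mixedPow a N (by omega)) le_rfl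
  exact hle hy'

theorem mem_pow_smul_of_mem_mixedPow {I a : Ideal R}
    (hI : ∀ n, ∀ g ∈ a ^ n, g • finsetProd θ Finset.univ = 0 → g ∈ a ^ n * I)
    (hI2 : I • (1 : Submodule R B) ≤ Submodule.span R (Set.range θ) ^ 2) {n : ℕ} {z : B}
    (hz : z ∈ Submodule.span R {finsetProd θ Finset.univ})
    (hzn : z ∈ mixedPow a (Submodule.span R (Set.range θ)) n) :
    z ∈ a ^ (n - Fintype.card ι) • Submodule.span R {finsetProd θ Finset.univ} := by
  rw [← h.span_pow_card] at hz ⊢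
  have tail (k : ℕ) (hk : k ≤ Fintype.card ι) :
      z ∈ mixedPow a (Submodule.span R (Set.range θ)) (n - k) *
        Submodule.span R (Set.range θ) ^ k := by
    induction k with
    | zero => simpa using hzn
    | succ k ih =>
      exact Nat.sub_sub n k 1 ▸ h.mem_mixedPow_mul_pow_succ hI hI2 hk hz (ih (by omega))
  have := mixedPow_mul_pow_le _ _ _ _ (tail _ le_rfl)
  rwa [h.span_pow_eq_bot (Nat.lt_succ_self _), Submodule.mul_bot, sup_bot_eq] at this

end IsAnticommuting

end MixedPow

section Components

variable {A : Type u} [Ring A] (𝒜 : ZMod 2 → AddSubgroup A) [GradedRing 𝒜]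

theorem odd_mul_odd_mem {a b : A} (ha : a ∈ 𝒜 1) (hb : b ∈ 𝒜 1) : a * b ∈ 𝒜 0 :=
  SetLike.mul_mem_graded (i := (1 : ZMod 2)) (j := 1) ha hb

theorem even_mul_mem {i : ZMod 2} {a b : A} (ha : a ∈ 𝒜 0) (hb : b ∈ 𝒜 i) : a * b ∈ 𝒜 i :=
  zero_add i ▸ SetLike.mul_mem_graded ha hb

theorem coe_decompose_mul (a b : A) (i : ZMod 2) :
    (DirectSum.decompose 𝒜 (a * b) i : A) =
      DirectSum.decompose 𝒜 a 0 * DirectSum.decompose 𝒜 b i +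
        DirectSum.decompose 𝒜 a 1 * DirectSum.decompose 𝒜 b (i + 1) := by
  have h0 := DirectSum.coe_decompose_mul_add_of_left_mem 𝒜 (j := i) (b := b)
    (DirectSum.decompose 𝒜 a 0).2
  have h1 := DirectSum.coe_decompose_mul_add_of_left_mem 𝒜 (j := i + 1) (b := b)
    (DirectSum.decompose 𝒜 a 1).2
  rw [zero_add] at h0
  rw [(by decide : ∀ i : ZMod 2, 1 + (i + 1) = i) i] at h1
  conv_lhs => rw [eq_even_add_odd 𝒜 a, add_mul, DirectSum.decompose_add, DirectSum.add_apply,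
    AddSubgroup.coe_add, h0, h1]

end Components

section Even

variable {A : Type u} [Ring A] (𝒜 : ZMod 2 → AddSubgroup A) [GradedRing 𝒜] [SuperCommutative 𝒜]

/-- `A` as an algebra over its even part, which is central. -/
instance evenAlgebra : Algebra (𝒜 0) A :=
  RingHom.toAlgebra'
    { toFun := fun a => (a : A)
      map_one' := rfl
      map_mul' := fun _ _ => rfl
      map_zero' := rfl
      map_add' := fun _ _ => rfl }
    (fun a b => even_commute 𝒜 a.2 b)

/-- The homogeneous component `Aᵢ`, as a module over the even part. -/
def component (i : ZMod 2) : Submodule (𝒜 0) A where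
  __ := 𝒜 i
  smul_mem' a _ hb := even_mul_mem 𝒜 a.2 hb

theorem component_sup : component 𝒜 0 ⊔ component 𝒜 1 = ⊤ := by
  rw [eq_top_iff]
  intro a _
  obtain ⟨b, hb, c, hc, rfl⟩ := exists_even_add_odd 𝒜 a
  exact Submodule.add_mem_sup hb hc

theorem one_eq_component : (1 : Submodule (𝒜 0) A) = component 𝒜 0 := by
  ext a
  exact Submodule.mem_one.trans ⟨fun ⟨b, hb⟩ => hb ▸ b.2, fun ha => ⟨⟨a, ha⟩, rfl⟩⟩

variable {𝒜} in
theorem mem_of_mem_span_component {i : ZMod 2} {L : Submodule (𝒜 0) A} (hL : L ≤ component 𝒜 i)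
    {a : A} (ha : a ∈ Ideal.span (L : Set A)) (hai : a ∈ 𝒜 i) : a ∈ L := by
  suffices h : (DirectSum.decompose 𝒜 a i : A) ∈ L by
    rwa [DirectSum.decompose_of_mem_same _ hai] at h
  clear hai
  induction ha using Submodule.closure_induction with
  | zero => rw [DirectSum.decompose_zero]; exact zero_mem _
  | add x y _ _ hx hy => rw [DirectSum.decompose_add]; exact add_mem hx hy
  | smul_mem r x hx =>
    have hr := DirectSum.coe_decompose_mul_add_of_right_mem 𝒜 (i := 0) (a := r) (hL hx)
    rw [zero_add] at hr
    rw [smul_eq_mul, hr]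
    exact L.smul_mem (DirectSum.decompose 𝒜 r 0) hx

variable (hA : IsNoetherianSuperRing 𝒜)
include hA

-- A submodule of a homogeneous component is recovered from the super-ideal that it generates.
theorem isNoetherian_component (i : ZMod 2) : IsNoetherian (𝒜 0) (component 𝒜 i) := by
  rw [isNoetherian_iff']
  let generated (L : Submodule (𝒜 0) (component 𝒜 i)) : HomogeneousIdeal 𝒜 :=
    ⟨Ideal.span (L.map (component 𝒜 i).subtype : Set A), Ideal.homogeneous_span 𝒜 _ (by
      rintro _ ⟨x, -, rfl⟩
      exact ⟨i, x.2⟩)⟩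
  have le_of_eq (L L' : Submodule (𝒜 0) (component 𝒜 i)) (h : generated L = generated L') :
      L ≤ L' := by
    intro x hx
    have hx' : (x : A) ∈ (generated L').toIdeal := h ▸ Ideal.subset_span ⟨x, hx, rfl⟩
    obtain ⟨y, hy, e⟩ := mem_of_mem_span_component (Submodule.map_subtype_le _ L') hx' x.2
    rwa [← Subtype.ext e]
  have hmono : StrictMono generated := Monotone.strictMono_of_injective
    (fun _ _ h => toIdeal_le_toIdeal_iff.1 (Ideal.span_mono (Submodule.map_mono h)))
    (fun L L' h => le_antisymm (le_of_eq L L' h) (le_of_eq L' L h.symm))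
  exact hmono.wellFoundedGT

theorem isNoetherian_even : IsNoetherian (𝒜 0) A := by
  have := isNoetherian_component 𝒜 hA 0
  have := isNoetherian_component 𝒜 hA 1
  have h : IsNoetherian (𝒜 0) ↥(component 𝒜 0 ⊔ component 𝒜 1) := inferInstance
  rw [component_sup] at h
  exact isNoetherian_of_linearEquiv Submodule.topEquiv

theorem isNoetherianRing_even : IsNoetherianRing (𝒜 0) :=
  have := isNoetherian_even 𝒜 hA
  isNoetherian_of_injective (Algebra.linearMap (𝒜 0) A) Subtype.val_injective

end Even

section Residue

variable {A : Type u} [Ring A] (𝒜 : ZMod 2 → AddSubgroup A) [GradedRing 𝒜]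

theorem decompose_mul_zero (a b : A) :
    DirectSum.decompose 𝒜 (a * b) 0 =
      DirectSum.decompose 𝒜 a 0 * DirectSum.decompose 𝒜 b 0 +
        ⟨DirectSum.decompose 𝒜 a 1 * DirectSum.decompose 𝒜 b 1,
          odd_mul_odd_mem 𝒜 (DirectSum.decompose 𝒜 a 1).2 (DirectSum.decompose 𝒜 b 1).2⟩ :=
  Subtype.ext (coe_decompose_mul 𝒜 a b 0)

variable [SuperCommutative 𝒜] {𝒜}

theorem odd_mul_odd_mul_self {a b : A} (ha : a ∈ 𝒜 1) (hb : b ∈ 𝒜 1) : a * b * (a * b) = 0 := by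
  rw [mul_assoc, ← mul_assoc b, odd_anticommute 𝒜 hb ha, neg_mul, mul_neg, mul_assoc,
    SuperCommutative.odd_sq hb, mul_zero, mul_zero, neg_zero]

theorem odd_mul_odd_mem_of_isPrime (p : Ideal (𝒜 0)) [hp : p.IsPrime] {a b : A} (ha : a ∈ 𝒜 1)
    (hb : b ∈ 𝒜 1) : (⟨a * b, odd_mul_odd_mem 𝒜 ha hb⟩ : 𝒜 0) ∈ p := by
  refine hp.mem_of_pow_mem 2 ?_
  have hsq : (⟨a * b, odd_mul_odd_mem 𝒜 ha hb⟩ : 𝒜 0) ^ 2 = 0 :=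
    (pow_two _).trans (Subtype.ext (odd_mul_odd_mul_self ha hb))
  rw [hsq]
  exact zero_mem p

/-- The projection of `A` onto `A₀ / p`, for a prime ideal `p` of `A₀`. It is multiplicative because
the products of two odd elements are nilpotent. -/
def evenQuotientHom (p : Ideal (𝒜 0)) [p.IsPrime] : A →+* 𝒜 0 ⧸ p where
  toFun a := Ideal.Quotient.mk p (DirectSum.decompose 𝒜 a 0)
  map_zero' := by rw [DirectSum.decompose_zero]; exact map_zero _
  map_add' a b := by rw [DirectSum.decompose_add, DirectSum.add_apply, map_add]
  map_one' := congrArg (Ideal.Quotient.mk p)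
    (Subtype.ext (DirectSum.decompose_of_mem_same _ SetLike.GradedOne.one_mem))
  map_mul' a b := by
    rw [decompose_mul_zero, map_add, map_mul, Ideal.Quotient.eq_zero_iff_mem.2
      (odd_mul_odd_mem_of_isPrime p (DirectSum.decompose 𝒜 a 1).2 (DirectSum.decompose 𝒜 b 1).2),
      add_zero]

theorem evenQuotientHom_coe (p : Ideal (𝒜 0)) [p.IsPrime] (a : 𝒜 0) :
    evenQuotientHom p (a : A) = Ideal.Quotient.mk p a :=
  congrArg (Ideal.Quotient.mk p) (Subtype.ext (DirectSum.decompose_of_mem_same _ a.2))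

theorem evenQuotientHom_of_odd (p : Ideal (𝒜 0)) [p.IsPrime] {a : A} (ha : a ∈ 𝒜 1) :
    evenQuotientHom p a = 0 := by
  rw [← map_zero (Ideal.Quotient.mk p)]
  exact congrArg (Ideal.Quotient.mk p)
    (Subtype.ext (DirectSum.decompose_of_mem_ne _ ha one_ne_zero))

/-- The super-ideal `p ⊕ A₁`, for a prime ideal `p` of `A₀`. -/
def superIdealOfPrime (p : Ideal (𝒜 0)) [p.IsPrime] : HomogeneousIdeal 𝒜 :=
  ⟨RingHom.ker (evenQuotientHom p), fun i a ha => by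
    obtain rfl | rfl : i = 0 ∨ i = 1 := by revert i; decide
    · exact (evenQuotientHom_coe p _).trans ha
    · exact evenQuotientHom_of_odd p (DirectSum.decompose 𝒜 a 1).2⟩

theorem isMaximalSuperIdeal_superIdealOfPrime (p : Ideal (𝒜 0)) [p.IsMaximal] :
    IsMaximalSuperIdeal (superIdealOfPrime p) where
  isField := by
    have hs : Function.Surjective (evenQuotientHom p) := by
      intro z
      obtain ⟨a, rfl⟩ := Ideal.Quotient.mk_surjective z
      exact ⟨a, evenQuotientHom_coe p a⟩
    exact (RingHom.quotientKerEquivOfSurjective hs).toMulEquiv.isField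
      ((Ideal.Quotient.maximal_ideal_iff_isField_quotient p).1 inferInstance)

/-- The even part `I ∩ A₀` of a super-ideal `I`. -/
def evenPart (I : HomogeneousIdeal 𝒜) : Ideal (𝒜 0) := I.toIdeal.comap (algebraMap (𝒜 0) A)

theorem mem_evenPart {I : HomogeneousIdeal 𝒜} {a : 𝒜 0} : a ∈ evenPart I ↔ (a : A) ∈ I.toIdeal :=
  Iff.rfl

theorem evenPart_superIdealOfPrime (p : Ideal (𝒜 0)) [p.IsPrime] :
    evenPart (superIdealOfPrime p) = p := by
  ext a
  rw [mem_evenPart]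
  change evenQuotientHom p (a : A) = 0 ↔ a ∈ p
  rw [evenQuotientHom_coe, Ideal.Quotient.eq_zero_iff_mem]

theorem coe_mem_pow {I : HomogeneousIdeal 𝒜} {n : ℕ} {b : 𝒜 0} (hb : b ∈ evenPart I ^ n) :
    (b : A) ∈ I.toIdeal ^ n := by
  induction n generalizing b with
  | zero => rw [Submodule.pow_zero, Ideal.one_eq_top]; trivial
  | succ n ih =>
    rw [pow_succ] at hb
    induction hb using Submodule.mul_induction_on' with
    | mem_mul_mem c hc d hd => exact mul_mem_pow_add (ih hc) (by rwa [Submodule.pow_one])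
    | add c _ d _ hc hd => exact add_mem hc hd

variable (m : HomogeneousIdeal 𝒜) [IsMaximalSuperIdeal m]

theorem mem_iff_decompose {a : A} :
    a ∈ m.toIdeal ↔ DirectSum.decompose 𝒜 a 0 ∈ evenPart m := by
  conv_lhs => rw [eq_even_add_odd 𝒜 a]
  exact Submodule.add_mem_iff_left _ (odd_mem m (DirectSum.decompose 𝒜 a 1).2)

/-- The projection of the even part of `A` onto the residue field. -/
noncomputable def evenResidue : 𝒜 0 →+* ResidueField m :=
  (Ideal.Quotient.mk m.toIdeal).comp (algebraMap (𝒜 0) A)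

theorem evenResidue_eq_zero {a : 𝒜 0} : evenResidue m a = 0 ↔ a ∈ evenPart m :=
  Ideal.Quotient.eq_zero_iff_mem

theorem evenResidue_surjective : Function.Surjective (evenResidue m) := by
  intro z
  obtain ⟨a, rfl⟩ := Ideal.Quotient.mk_surjective z
  obtain ⟨b, hb, c, hc, rfl⟩ := exists_even_add_odd 𝒜 a
  refine ⟨⟨b, hb⟩, ((Ideal.Quotient.mk_eq_mk_iff_sub_mem _ _).2 ?_).symm⟩
  exact (add_sub_cancel_left b c).symm ▸ odd_mem m hc

theorem evenResidue_smul_grMk {n : ℕ} (a : 𝒜 0) (b : ↥(m.toIdeal ^ n)) :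
    evenResidue m a • grMk m.toIdeal n b = grMk m.toIdeal n ((a : A) • b) := rfl

theorem isMaximal_evenPart : (evenPart m).IsMaximal := by
  have hker : RingHom.ker (evenResidue m) = evenPart m := Ideal.ext fun _ => evenResidue_eq_zero m
  exact hker ▸
    RingHom.ker_isMaximal_of_surjective (K := ResidueField m) _ (evenResidue_surjective m)

theorem evenPart_eq_maximalIdeal [IsLocalRing (𝒜 0)] :
    evenPart m = IsLocalRing.maximalIdeal (𝒜 0) :=
  IsLocalRing.eq_maximalIdeal (isMaximal_evenPart m)

end Residue

section Local

variable {A : Type u} [Ring A] {𝒜 : ZMod 2 → AddSubgroup A} [GradedRing 𝒜] [SuperCommutative 𝒜]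
variable (m : HomogeneousIdeal 𝒜) [hm : IsLocalSuperRing m]
include hm

theorem isLocalRing_even : IsLocalRing (𝒜 0) := by
  refine .of_unique_max_ideal ⟨evenPart m, isMaximal_evenPart m, fun p hp => ?_⟩
  rw [← hm.unique _ (isMaximalSuperIdeal_superIdealOfPrime p), evenPart_superIdealOfPrime]

theorem evenPart_le_jacobson : evenPart m ≤ (⊥ : Ideal (𝒜 0)).jacobson := by
  have := isLocalRing_even m
  exact (evenPart_eq_maximalIdeal m).le.trans (IsLocalRing.maximalIdeal_le_jacobson ⊥)

end Local

section OddSq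

variable {A : Type u} [Ring A] {𝒜 : ZMod 2 → AddSubgroup A} [GradedRing 𝒜] [SuperCommutative 𝒜]

variable (𝒜) in
/-- The ideal `A₁² ∩ A₀` of the even part, generated by the products of two odd elements. -/
def oddSqIdeal : Ideal (𝒜 0) := (component 𝒜 1 ^ 2).comap (Algebra.linearMap (𝒜 0) A)

theorem mem_oddSqIdeal {a : 𝒜 0} : a ∈ oddSqIdeal 𝒜 ↔ (a : A) ∈ component 𝒜 1 ^ 2 := Iff.rfl

theorem oddSqIdeal_smul_one_le : oddSqIdeal 𝒜 • (1 : Submodule (𝒜 0) A) ≤ component 𝒜 1 ^ 2 := by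
  refine Submodule.smul_le.2 fun a ha b hb => ?_
  obtain ⟨c, rfl⟩ := Submodule.mem_one.1 hb
  rw [Algebra.smul_def, ← map_mul]
  exact Ideal.mul_mem_right c _ ha

theorem oddSqIdeal_le_of_isPrime (p : Ideal (𝒜 0)) [p.IsPrime] : oddSqIdeal 𝒜 ≤ p := by
  have h : component 𝒜 1 ^ 2 ≤ Submodule.map (Algebra.linearMap (𝒜 0) A) p := by
    rw [pow_two, Submodule.mul_le]
    exact fun a ha b hb => ⟨_, odd_mul_odd_mem_of_isPrime p ha hb, rfl⟩
  intro a ha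
  obtain ⟨b, hb, e⟩ := h ha
  rwa [← Subtype.ext e]

theorem ringKrullDim_quotient_oddSqIdeal :
    ringKrullDim (𝒜 0 ⧸ oddSqIdeal 𝒜) = ringKrullDim (𝒜 0) := by
  have e : PrimeSpectrum.zeroLocus (oddSqIdeal 𝒜 : Set (𝒜 0)) = Set.univ :=
    Set.eq_univ_of_forall fun p => oddSqIdeal_le_of_isPrime p.asIdeal
  rw [ringKrullDim_quotient, e]
  exact Order.krullDim_eq_of_orderIso OrderIso.Set.univ

variable {m : HomogeneousIdeal 𝒜} [IsMaximalSuperIdeal m]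

theorem mem_mixedPow_of_mem_pow {a : Ideal (𝒜 0)} (ha : evenPart m ≤ a ⊔ oddSqIdeal 𝒜) (n : ℕ)
    {z : A} (hz : z ∈ m.toIdeal ^ n) : z ∈ mixedPow a (component 𝒜 1) n := by
  induction n generalizing z with
  | zero =>
    rw [mixedPow_zero_eq_top _ _ (one_eq_component 𝒜 ▸ component_sup 𝒜)]
    trivial
  | succ n ih =>
    have hmul : ∀ x ∈ m.toIdeal, ∀ y ∈ mixedPow a (component 𝒜 1) n,
        x * y ∈ mixedPow a (component 𝒜 1) (n + 1) := by
      intro x hx y hy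
      rw [mem_iff_decompose] at hx
      obtain ⟨b, hb, c, hc, e⟩ := Submodule.mem_sup.1 (ha hx)
      rw [eq_even_add_odd 𝒜 x, ← e, add_mul, AddSubgroup.coe_add, add_mul]
      refine add_mem (add_mem ?_ ?_) ?_
      · exact smul_mixedPow_le a _ n (Submodule.smul_mem_smul hb hy)
      · have h := Submodule.mul_mem_mul (mem_oddSqIdeal.1 hc) hy
        rw [pow_two, mul_assoc] at h
        exact mixedPow_succ_le _ _ _ (mul_mixedPow_le a _ (n + 1)
          (mul_le_mul' le_rfl (mul_mixedPow_le a _ n) h))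
      · exact mul_mixedPow_le a _ n (Submodule.mul_mem_mul (DirectSum.decompose 𝒜 x 1).2 hy)
    rw [Ideal.IsTwoSided.pow_succ] at hz
    induction hz using Submodule.smul_induction_on' with
    | smul x hx y hy => exact hmul x hx y (ih hy)
    | add x _ y _ hx hy => exact add_mem hx hy

theorem decompose_mem_of_mem_sq {z : A} (hz : z ∈ m.toIdeal ^ 2) :
    DirectSum.decompose 𝒜 z 0 ∈ evenPart m * evenPart m ⊔ oddSqIdeal 𝒜 ∧
      (DirectSum.decompose 𝒜 z 1 : A) ∈ evenPart m • component 𝒜 1 := by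
  rw [Ideal.IsTwoSided.pow_succ, Submodule.pow_one] at hz
  induction hz using Submodule.smul_induction_on' with
  | smul x hx y hy =>
    rw [mem_iff_decompose] at hx hy
    rw [smul_eq_mul]
    constructor
    · rw [decompose_mul_zero]
      refine Submodule.add_mem_sup (Ideal.mul_mem_mul hx hy) (mem_oddSqIdeal.2 ?_)
      rw [pow_two]
      exact Submodule.mul_mem_mul (DirectSum.decompose 𝒜 x 1).2 (DirectSum.decompose 𝒜 y 1).2
    · rw [coe_decompose_mul, show (1 + 1 : ZMod 2) = 0 from rfl,
        ← even_commute 𝒜 (DirectSum.decompose 𝒜 y 0).2]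
      exact add_mem (Submodule.smul_mem_smul hx (DirectSum.decompose 𝒜 y 1).2)
        (Submodule.smul_mem_smul hy (DirectSum.decompose 𝒜 x 1).2)
  | add x _ y _ hx hy =>
    rw [DirectSum.decompose_add]
    exact ⟨add_mem hx.1 hy.1, add_mem hx.2 hy.2⟩

end OddSq

section Parameters

variable {A : Type u} [Ring A] {𝒜 : ZMod 2 → AddSubgroup A} [GradedRing 𝒜] [SuperCommutative 𝒜]
variable (m : HomogeneousIdeal 𝒜) [IsMaximalSuperIdeal m]

/-- Even elements `x` and odd elements `θ` of `𝔪` whose classes are bases of the two components of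
`𝔪/𝔪²`. -/
structure Parameters (r q : ℕ) where
  evenBasis : Module.Basis (Fin r) (ResidueField m) (cotangentPart m 0)
  oddBasis : Module.Basis (Fin q) (ResidueField m) (cotangentPart m 1)
  x : Fin r → 𝒜 0
  θ : Fin q → A
  x_mem : ∀ i, (x i : A) ∈ m.toIdeal ^ 1
  θ_odd : ∀ i, θ i ∈ 𝒜 1
  θ_mem : ∀ i, θ i ∈ m.toIdeal ^ 1
  x_class : ∀ i, grMk m.toIdeal 1 ⟨x i, x_mem i⟩ = evenBasis i
  θ_class : ∀ i, grMk m.toIdeal 1 ⟨θ i, θ_mem i⟩ = oddBasis i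

theorem finite_cotangentPart (hA : IsNoetherianSuperRing 𝒜) (i : ZMod 2) :
    Module.Finite (ResidueField m) (cotangentPart m i) := by
  have := isNoetherian_even 𝒜 hA
  have : IsNoetherian A A := isNoetherian_of_tower (𝒜 0) this
  have : Module.Finite A (GrPiece m.toIdeal 1) :=
    Module.Finite.of_surjective (grMk m.toIdeal 1) (grMk_surjective 1)
  have : IsScalarTower A (ResidueField m) (GrPiece m.toIdeal 1) :=
    (isTorsionBySet_grPiece m 1).isScalarTower
  have : Module.Finite (ResidueField m) (GrPiece m.toIdeal 1) :=
    Module.Finite.of_restrictScalars_finite A _ _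
  infer_instance

theorem exists_parameters (hA : IsNoetherianSuperRing 𝒜) :
    ∃ r q, Nonempty (Parameters m r q) := by
  have := finite_cotangentPart m hA 0
  have := finite_cotangentPart m hA 1
  let b₀ := Module.finBasis (ResidueField m) (cotangentPart m 0)
  let b₁ := Module.finBasis (ResidueField m) (cotangentPart m 1)
  choose x hx hx' using fun i => (b₀ i).2
  choose y hy hy' using fun i => (b₁ i).2
  exact ⟨_, _, ⟨b₀, b₁, fun i => ⟨x i, hx i⟩, fun i => y i, fun i => (x i).2, hy,
    fun i => (y i).2, hx', hy'⟩⟩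

theorem exists_sub_sum_mem_sq {i : ZMod 2} {k : ℕ}
    (b : Module.Basis (Fin k) (ResidueField m) (cotangentPart m i)) {y : Fin k → A}
    (hy : ∀ j, y j ∈ m.toIdeal ^ 1) (hyb : ∀ j, grMk m.toIdeal 1 ⟨y j, hy j⟩ = b j)
    {a : A} (ha : a ∈ 𝒜 i) (ham : a ∈ m.toIdeal) :
    ∃ d : Fin k → 𝒜 0, a - ∑ j, d j • y j ∈ m.toIdeal ^ 2 := by
  have ham' : a ∈ m.toIdeal ^ 1 := by rwa [Submodule.pow_one]
  let v : cotangentPart m i := ⟨grMk m.toIdeal 1 ⟨a, ham'⟩, ⟨a, ham'⟩, ha, rfl⟩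
  choose d hd using fun j => evenResidue_surjective m (b.repr v j)
  have hv : grMk m.toIdeal 1 ⟨a, ham'⟩ =
      grMk m.toIdeal 1 (∑ j, (d j : A) • (⟨y j, hy j⟩ : ↥(m.toIdeal ^ 1))) := by
    have hsum := congrArg (cotangentPart m i).subtype (b.sum_repr v)
    rw [map_sum] at hsum ⊢
    refine hsum.symm.trans (Finset.sum_congr rfl fun j _ => ?_)
    rw [map_smul, ← hd j, Submodule.subtype_apply, ← hyb j, evenResidue_smul_grMk]
  have hmem := grMk_eq_iff.1 hv
  rw [AddSubmonoidClass.coe_finsetSum] at hmem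
  exact ⟨d, hmem⟩

namespace Parameters

variable {m} {r q : ℕ} (p : Parameters m r q)

theorem x_mem_evenPart (i : Fin r) : p.x i ∈ evenPart m := by
  have h := p.x_mem i
  rwa [Submodule.pow_one] at h

theorem span_x_le : Ideal.span (Set.range p.x) ≤ evenPart m := by
  rw [Ideal.span_le]
  rintro _ ⟨i, rfl⟩
  exact p.x_mem_evenPart i

theorem isAnticommuting : IsAnticommuting p.θ where
  anti i j := odd_anticommute 𝒜 (p.θ_odd i) (p.θ_odd j)
  sq i := SuperCommutative.odd_sq (p.θ_odd i)

/-- The product of all the odd parameters. -/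
noncomputable def top : A := finsetProd p.θ Finset.univ

end Parameters

end Parameters

section Nakayama

variable {A : Type u} [Ring A] {𝒜 : ZMod 2 → AddSubgroup A} [GradedRing 𝒜] [SuperCommutative 𝒜]
variable {m : HomogeneousIdeal 𝒜} [IsLocalSuperRing m]

namespace Parameters

variable {r q : ℕ} (p : Parameters m r q) (hA : IsNoetherianSuperRing 𝒜)
include p hA

theorem evenPart_eq : evenPart m = Ideal.span (Set.range p.x) ⊔ oddSqIdeal 𝒜 := by
  have := isNoetherianRing_even 𝒜 hA
  have := isMaximal_evenPart m
  refine le_antisymm ?_ (sup_le p.span_x_le (oddSqIdeal_le_of_isPrime _))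
  refine Submodule.le_of_le_smul_of_le_jacobson_bot (IsNoetherian.noetherian _)
    (evenPart_le_jacobson m) fun a ha => ?_
  obtain ⟨d, hd⟩ := exists_sub_sum_mem_sq m p.evenBasis p.x_mem p.x_class a.2 ha
  have hsum : ∑ j, d j * p.x j ∈ Ideal.span (Set.range p.x) :=
    sum_mem fun j _ => Ideal.mul_mem_left _ _ (Ideal.subset_span ⟨j, rfl⟩)
  have hdiff : a - ∑ j, d j * p.x j ∈ evenPart m * evenPart m ⊔ oddSqIdeal 𝒜 := by
    have e : (a : A) - ∑ j, d j • (p.x j : A) = ((a - ∑ j, d j * p.x j : 𝒜 0) : A) := by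
      rw [AddSubgroup.coe_sub, AddSubmonoidClass.coe_finsetSum]
      rfl
    have h := (decompose_mem_of_mem_sq hd).1
    rwa [e, Subtype.ext (DirectSum.decompose_of_mem_same 𝒜 (Subtype.prop _))] at h
  rw [sup_assoc, sup_comm (oddSqIdeal 𝒜), ← sub_add_cancel a (∑ j, d j * p.x j), add_comm]
  exact Submodule.add_mem_sup hsum hdiff

theorem span_θ : Submodule.span (𝒜 0) (Set.range p.θ) = component 𝒜 1 := by
  have := isNoetherian_even 𝒜 hA
  have hle : Submodule.span (𝒜 0) (Set.range p.θ) ≤ component 𝒜 1 := by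
    rw [Submodule.span_le]
    rintro _ ⟨i, rfl⟩
    exact p.θ_odd i
  refine le_antisymm hle (Submodule.le_of_le_smul_of_le_jacobson_bot (IsNoetherian.noetherian _)
    (evenPart_le_jacobson m) fun a ha => ?_)
  obtain ⟨d, hd⟩ := exists_sub_sum_mem_sq m p.oddBasis p.θ_mem p.θ_class ha (odd_mem m ha)
  have hsum : ∑ j, d j • p.θ j ∈ Submodule.span (𝒜 0) (Set.range p.θ) :=
    sum_mem fun j _ => Submodule.smul_mem _ (d j) (Submodule.subset_span ⟨j, rfl⟩)
  have hdiff := (decompose_mem_of_mem_sq hd).2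
  rw [DirectSum.decompose_of_mem_same 𝒜 (sub_mem ha (hle hsum))] at hdiff
  rw [← sub_add_cancel a (∑ j, d j • p.θ j), add_comm]
  exact Submodule.add_mem_sup hsum hdiff

theorem component_pow_eq_bot {k : ℕ} (hk : q < k) : component 𝒜 1 ^ k = ⊥ := by
  rw [← p.span_θ hA]
  exact p.isAnticommuting.span_pow_eq_bot (by rwa [Fintype.card_fin])

theorem component_pow_eq_span_top : component 𝒜 1 ^ q = Submodule.span (𝒜 0) {p.top} := by
  have h := p.isAnticommuting.span_pow_card (R := 𝒜 0)
  rwa [Fintype.card_fin, p.span_θ hA] at h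

theorem oddSqIdeal_le_evenAnnihilator : oddSqIdeal 𝒜 ≤ evenAnnihilator 𝒜 p.top := by
  intro a ha
  have htop : p.top ∈ component 𝒜 1 ^ q :=
    p.component_pow_eq_span_top hA ▸ Submodule.mem_span_singleton_self _
  have hmul := Submodule.mul_mem_mul (mem_oddSqIdeal.1 ha) htop
  rwa [← pow_add, p.component_pow_eq_bot hA (by omega), Submodule.mem_bot] at hmul

end Parameters

end Nakayama

section Symbol

variable {A : Type u} [Ring A]

/-- `z` is the symbol in degree `n` of `a ∈ Iⁿ`: the class of `a` in the component `Iⁿ/Iⁿ⁺¹` of the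
associated graded ring. A relation rather than a function of `a`, so that equal elements of equal
degrees can be exchanged by rewriting. -/
def IsSymbol (I : Ideal A) (n : ℕ) (a : A) (z : ⨁ k, GrPiece I k) : Prop :=
  ∃ h : a ∈ I ^ n, DirectSum.of (GrPiece I) n (grMk I n ⟨a, h⟩) = z

namespace IsSymbol

variable {I : Ideal A} {i j n : ℕ} {a b : A} {y z : ⨁ k, GrPiece I k}

theorem eq_zero_iff (h : IsSymbol I n a z) : z = 0 ↔ a ∈ I ^ (n + 1) := by
  obtain ⟨ha, rfl⟩ := h
  rw [map_eq_zero_iff _ (DirectSum.of_injective n), ← map_zero (grMk I n), grMk_eq_iff,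
    Submodule.coe_zero, sub_zero]

theorem apply_eq_zero_of_ne (h : IsSymbol I n a z) (hi : i ≠ n) : z i = 0 := by
  obtain ⟨ha, rfl⟩ := h
  exact DirectSum.of_eq_of_ne _ _ _ hi

theorem eq_zero_of_apply_eq_zero (h : IsSymbol I n a z) (hz : z n = 0) : z = 0 := by
  obtain ⟨ha, rfl⟩ := h
  rw [DirectSum.of_eq_same] at hz
  rw [hz, map_zero]

theorem zero (n : ℕ) : IsSymbol I n 0 0 :=
  ⟨zero_mem _, (congrArg _ (map_zero (grMk I n))).trans (map_zero _)⟩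

theorem add (ha : IsSymbol I n a y) (hb : IsSymbol I n b z) : IsSymbol I n (a + b) (y + z) := by
  obtain ⟨ha, rfl⟩ := ha
  obtain ⟨hb, rfl⟩ := hb
  exact ⟨add_mem ha hb, (congrArg _ (map_add (grMk I n) ⟨a, ha⟩ ⟨b, hb⟩)).trans (map_add _ _ _)⟩

variable [I.IsTwoSided]

theorem one : IsSymbol I 0 1 1 := ⟨one_mem_pow_zero I, rfl⟩

theorem mul (ha : IsSymbol I i a y) (hb : IsSymbol I j b z) :
    IsSymbol I (i + j) (a * b) (y * z) := by
  obtain ⟨ha, rfl⟩ := ha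
  obtain ⟨hb, rfl⟩ := hb
  exact ⟨mul_mem_pow_add ha hb, (DirectSum.of_mul_of (grMk I i ⟨a, ha⟩) (grMk I j ⟨b, hb⟩)).symm⟩

theorem list_prod {ι : Type*} {l : List ι} {f : ι → A} {g : ι → ⨁ k, GrPiece I k}
    (h : ∀ i ∈ l, IsSymbol I 1 (f i) (g i)) :
    IsSymbol I l.length (l.map f).prod (l.map g).prod := by
  induction l with
  | nil => exact one
  | cons i l ih =>
    rw [List.map_cons, List.prod_cons, List.map_cons, List.prod_cons, List.length_cons, add_comm]
    exact (h i List.mem_cons_self).mul (ih fun j hj => h j (List.mem_cons_of_mem i hj))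

end IsSymbol

end Symbol

section Surjective

variable {A : Type u} [Ring A] {𝒜 : ZMod 2 → AddSubgroup A} [GradedRing 𝒜] [SuperCommutative 𝒜]
variable (m : HomogeneousIdeal 𝒜) [IsMaximalSuperIdeal m]

theorem isSymbol_algebraMap (a : A) :
    IsSymbol m.toIdeal 0 a
      (algebraMap (ResidueField m) (Gr m) (Ideal.Quotient.mk m.toIdeal a)) := by
  refine ⟨by rw [Submodule.pow_zero, Ideal.one_eq_top]; exact Submodule.mem_top, ?_⟩
  rw [DirectSum.algebraMap_apply]
  refine congrArg (DirectSum.of (GrPiece m.toIdeal) 0) ?_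
  refine Eq.trans ?_ (mk_smul_grMk m a ⟨1, one_mem_pow_zero _⟩).symm
  exact congrArg (grMk m.toIdeal 0) (Subtype.ext (mul_one a).symm)

theorem kappa_ι_tmul_one (v : cotangentPart m 0) :
    kappa m (SymmetricAlgebra.ι _ _ v ⊗ₜ 1) = cotangentIncl m 0 v := by
  refine (Algebra.TensorProduct.lift_tmul _ _ _ _ _).trans ?_
  rw [map_one, mul_one, kappaEven_ι]

theorem kappa_one_tmul_ι (v : cotangentPart m 1) :
    kappa m (1 ⊗ₜ ExteriorAlgebra.ι _ v) = cotangentIncl m 1 v := by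
  refine (Algebra.TensorProduct.lift_tmul _ _ _ _ _).trans ?_
  rw [map_one, one_mul, kappaOdd_ι]

variable {m}

theorem exists_isSymbol_kappa_of_mem {a : A} (ha : a ∈ m.toIdeal) :
    ∃ w, IsSymbol m.toIdeal 1 a (kappa m w) := by
  have hmem (i : ZMod 2) : (DirectSum.decompose 𝒜 a i : A) ∈ m.toIdeal ^ 1 := by
    rw [Submodule.pow_one]
    exact m.isHomogeneous i ha
  let v (i : ZMod 2) : cotangentPart m i :=
    ⟨grMk m.toIdeal 1 ⟨_, hmem i⟩, ⟨_, hmem i⟩, (DirectSum.decompose 𝒜 a i).2, rfl⟩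
  refine ⟨SymmetricAlgebra.ι _ _ (v 0) ⊗ₜ 1 + 1 ⊗ₜ ExteriorAlgebra.ι _ (v 1), ?_⟩
  rw [map_add, kappa_ι_tmul_one, kappa_one_tmul_ι, eq_even_add_odd 𝒜 a]
  exact IsSymbol.add ⟨hmem 0, rfl⟩ ⟨hmem 1, rfl⟩

theorem exists_isSymbol_kappa {n : ℕ} {a : A} (ha : a ∈ m.toIdeal ^ n) :
    ∃ w, IsSymbol m.toIdeal n a (kappa m w) := by
  induction n generalizing a with
  | zero =>
    refine ⟨algebraMap (ResidueField m) _ (Ideal.Quotient.mk m.toIdeal a), ?_⟩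
    rw [AlgHom.commutes]
    exact isSymbol_algebraMap m a
  | succ n ih =>
    rw [Ideal.IsTwoSided.pow_succ] at ha
    refine Submodule.smul_induction_on ha (fun b hb c hc => ?_) fun b c hb hc => ?_
    · obtain ⟨v, hv⟩ := exists_isSymbol_kappa_of_mem hb
      obtain ⟨w, hw⟩ := ih hc
      refine ⟨v * w, ?_⟩
      rw [map_mul, add_comm]
      exact hv.mul hw
    · obtain ⟨v, hv⟩ := hb
      obtain ⟨w, hw⟩ := hc
      exact ⟨v + w, by rw [map_add]; exact hv.add hw⟩

variable (m)

theorem kappa_surjective : Function.Surjective (kappa m) := by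
  intro z
  induction z using DirectSum.induction_on with
  | zero => exact ⟨0, map_zero _⟩
  | of n y =>
    obtain ⟨⟨a, ha⟩, rfl⟩ := grMk_surjective n y
    obtain ⟨w, _, hw⟩ := exists_isSymbol_kappa ha
    exact ⟨w, hw.symm⟩
  | add y z hy hz =>
    obtain ⟨v, rfl⟩ := hy
    obtain ⟨w, rfl⟩ := hz
    exact ⟨v + w, map_add _ _ _⟩

end Surjective

section SymbolForms

open MvPolynomial

variable {A : Type u} [Ring A] {I : Ideal A}

theorem IsSymbol.eq_zero_of_sum_eq_zero {s : Finset ℕ} {q : ℕ} {a : ℕ → A}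
    {z : ℕ → ⨁ k, GrPiece I k} (h : ∀ d, IsSymbol I (d + q) (a d) (z d))
    (hsum : ∑ d ∈ s, z d = 0) {d : ℕ} (hd : d ∈ s) : z d = 0 := by
  refine (h d).eq_zero_of_apply_eq_zero ?_
  have hcomp := congrArg (fun y : ⨁ k, GrPiece I k => y (d + q)) hsum
  simp only [DirectSum.sum_apply, DirectSum.zero_apply] at hcomp
  rwa [Finset.sum_eq_single_of_mem d hd fun e _ hed =>
    (h e).apply_eq_zero_of_ne (by omega)] at hcomp

theorem IsSymbol.sum {ι : Type*} {s : Finset ι} {n : ℕ} {a : ι → A} {z : ι → ⨁ k, GrPiece I k}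
    (h : ∀ i ∈ s, IsSymbol I n (a i) (z i)) : IsSymbol I n (∑ i ∈ s, a i) (∑ i ∈ s, z i) := by
  classical
  induction s using Finset.induction_on with
  | empty => exact .zero n
  | insert i s hi ih =>
    rw [Finset.sum_insert hi, Finset.sum_insert hi]
    exact (h i (Finset.mem_insert_self i s)).add (ih fun j hj => h j (Finset.mem_insert_of_mem hj))

variable [I.IsTwoSided]

theorem IsSymbol.pow {a : A} {z : ⨁ k, GrPiece I k} (h : IsSymbol I 1 a z) (n : ℕ) :
    IsSymbol I n (a ^ n) (z ^ n) := by
  induction n with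
  | zero => rw [pow_zero, pow_zero]; exact .one
  | succ n ih => rw [pow_succ, pow_succ]; exact ih.mul h

theorem IsSymbol.of_isHomogeneous {R σ : Type*} [CommRing R] {ψ : MvPolynomial σ R →+* A}
    {φ : MvPolynomial σ R →+* ⨁ k, GrPiece I k} (hC : ∀ c, IsSymbol I 0 (ψ (C c)) (φ (C c)))
    (hX : ∀ i, IsSymbol I 1 (ψ (X i)) (φ (X i))) {n : ℕ} {F : MvPolynomial σ R}
    (hF : F.IsHomogeneous n) : IsSymbol I n (ψ F) (φ F) := by
  have hmonomial (α : σ →₀ ℕ) (c : R) :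
      IsSymbol I α.degree (ψ (monomial α c)) (φ (monomial α c)) := by
    induction α using Finsupp.induction_linear generalizing c with
    | zero => rw [map_zero]; exact hC c
    | add α β hα hβ =>
      rw [← mul_one c, ← monomial_mul, map_mul, map_mul, map_add]
      exact (hα c).mul (hβ 1)
    | single i k =>
      rw [← C_mul_X_pow_eq_monomial, map_mul, map_mul, map_pow, map_pow, Finsupp.degree_single]
      have h := (hC c).mul ((hX i).pow k)
      rwa [zero_add] at h
  rw [F.as_sum, map_sum, map_sum]
  refine IsSymbol.sum fun α hα => ?_
  obtain rfl : α.degree = n := by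
    rw [Finsupp.degree_eq_weight_one]
    exact hF (mem_support_iff.1 hα)
  exact hmonomial α _

end SymbolForms

section ExteriorBasis

theorem isAnticommuting_ι {R M I : Type*} [CommRing R] [AddCommGroup M] [Module R M] (v : I → M) :
    IsAnticommuting fun i => ExteriorAlgebra.ι R (v i) where
  anti _ _ := eq_neg_of_add_eq_zero_left (ExteriorAlgebra.ι_add_mul_swap _ _)
  sq _ := ExteriorAlgebra.ι_sq_zero _

theorem finsetProd_ι_eq_basis {R M I : Type*} [CommRing R] [AddCommGroup M] [Module R M]
    [LinearOrder I] (b : Module.Basis I R M) (s : Finset I) :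
    finsetProd (fun i => ExteriorAlgebra.ι R (b i)) s = b.ExteriorAlgebra s ∨
      finsetProd (fun i => ExteriorAlgebra.ι R (b i)) s = -b.ExteriorAlgebra s := by
  let e := s.orderEmbOfFin rfl
  have hprod : b.ExteriorAlgebra s =
      ((List.ofFn e).map fun i => ExteriorAlgebra.ι R (b i)).prod := by
    rw [ExteriorAlgebra.basis_apply_ofCard b rfl, List.map_ofFn]
    exact ExteriorAlgebra.ιMulti_apply _
  have hnodup : (List.ofFn e).Nodup := List.nodup_ofFn.2 e.injective
  rw [hprod, finsetProd]
  refine (isAnticommuting_ι b).prod_perm ((List.perm_ext_iff_of_nodup s.nodup_toList hnodup).2 ?_)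
  intro i
  rw [Finset.mem_toList, List.mem_ofFn', Finset.range_orderEmbOfFin, Finset.mem_coe]

variable {R S M I : Type*} [CommRing R] [CommRing S] [Algebra R S] [AddCommGroup M] [Module R M]
  [LinearOrder I] (b : Module.Basis I R M)

theorem finsetProd_one_tmul_ι_eq_basis (s : Finset I) :
    finsetProd (fun i => (1 : S) ⊗ₜ[R] ExteriorAlgebra.ι R (b i)) s =
        Algebra.TensorProduct.basis S b.ExteriorAlgebra s ∨
      finsetProd (fun i => (1 : S) ⊗ₜ[R] ExteriorAlgebra.ι R (b i)) s =
        -Algebra.TensorProduct.basis S b.ExteriorAlgebra s := by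
  have hmap : finsetProd (fun i => (1 : S) ⊗ₜ[R] ExteriorAlgebra.ι R (b i)) s =
      (1 : S) ⊗ₜ[R] finsetProd (fun i => ExteriorAlgebra.ι R (b i)) s :=
    (map_finsetProd (Algebra.TensorProduct.includeRight (R := R) (A := S)).toRingHom _ s).symm
  rw [hmap, Algebra.TensorProduct.basis_apply, ← TensorProduct.tmul_neg]
  exact (finsetProd_ι_eq_basis b s).imp (congrArg _) (congrArg _)

theorem span_finsetProd_one_tmul_ι :
    Submodule.span S (Set.range (finsetProd fun i => (1 : S) ⊗ₜ[R] ExteriorAlgebra.ι R (b i))) =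
      ⊤ := by
  rw [eq_top_iff, ← (Algebra.TensorProduct.basis S b.ExteriorAlgebra).span_eq, Submodule.span_le]
  rintro _ ⟨s, rfl⟩
  have hs : finsetProd (fun i => (1 : S) ⊗ₜ[R] ExteriorAlgebra.ι R (b i)) s ∈ Submodule.span S
      (Set.range (finsetProd fun i => (1 : S) ⊗ₜ[R] ExteriorAlgebra.ι R (b i))) :=
    Submodule.subset_span ⟨s, rfl⟩
  rcases finsetProd_one_tmul_ι_eq_basis (S := S) b s with e | e <;> rw [e] at hs
  · exact hs
  · exact (Submodule.neg_mem_iff _).1 hs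

theorem eq_zero_of_smul_finsetProd_one_tmul_ι_eq_zero {f : S} {s : Finset I}
    (h : f • finsetProd (fun i => (1 : S) ⊗ₜ[R] ExteriorAlgebra.ι R (b i)) s = 0) : f = 0 := by
  have hf : f • Algebra.TensorProduct.basis S b.ExteriorAlgebra s = 0 := by
    rcases finsetProd_one_tmul_ι_eq_basis (S := S) b s with e | e <;> rw [e] at h
    · exact h
    · rwa [smul_neg, neg_eq_zero] at h
  simpa using congrArg (fun z => (Algebra.TensorProduct.basis S b.ExteriorAlgebra).repr z s) hf

end ExteriorBasis

section Coordinates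

open MvPolynomial

variable {A : Type u} [Ring A] {𝒜 : ZMod 2 → AddSubgroup A} [GradedRing 𝒜] [SuperCommutative 𝒜]
variable {m : HomogeneousIdeal 𝒜} [IsMaximalSuperIdeal m] {r q : ℕ}

namespace Parameters

variable (p : Parameters m r q)

/-- The reduction modulo `𝔪` of the coefficients of a polynomial, followed by the substitution of
the basis of `(𝔪/𝔪²)₀` for the variables. -/
noncomputable def toSymmetric : MvPolynomial (Fin r) (𝒜 0) →+*
    SymmetricAlgebra (ResidueField m) (cotangentPart m 0) :=
  ((SymmetricAlgebra.equivMvPolynomial p.evenBasis).symm : _ →+* _).comp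
    (MvPolynomial.map (evenResidue m))

theorem toSymmetric_C (c : 𝒜 0) :
    p.toSymmetric (C c) = algebraMap (ResidueField m) _ (evenResidue m c) := by
  change (SymmetricAlgebra.equivMvPolynomial p.evenBasis).symm (MvPolynomial.map _ (C c)) = _
  rw [map_C, ← algebraMap_eq, AlgEquiv.commutes]

theorem toSymmetric_X (i : Fin r) :
    p.toSymmetric (X i) = SymmetricAlgebra.ι _ _ (p.evenBasis i) := by
  change (SymmetricAlgebra.equivMvPolynomial p.evenBasis).symm (MvPolynomial.map _ (X i)) = _
  rw [map_X, SymmetricAlgebra.equivMvPolynomial_symm_X]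

theorem toSymmetric_surjective : Function.Surjective p.toSymmetric :=
  (SymmetricAlgebra.equivMvPolynomial p.evenBasis).symm.surjective.comp
    (MvPolynomial.map_surjective _ (evenResidue_surjective m))

theorem toSymmetric_eq_zero_iff {F : MvPolynomial (Fin r) (𝒜 0)} :
    p.toSymmetric F = 0 ↔ ∀ α, F.coeff α ∈ evenPart m := by
  have h : p.toSymmetric F = 0 ↔ MvPolynomial.map (evenResidue m) F = 0 :=
    map_eq_zero_iff (SymmetricAlgebra.equivMvPolynomial p.evenBasis).symm
      (SymmetricAlgebra.equivMvPolynomial p.evenBasis).symm.injective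
  rw [h, MvPolynomial.ext_iff]
  refine forall_congr' fun α => ?_
  rw [coeff_map, coeff_zero, evenResidue_eq_zero]

/-- The basis of `(𝔪/𝔪²)₁`, as a family of elements of the source of `κ`. -/
noncomputable def oddTensor (i : Fin q) :
    SymmetricAlgebra (ResidueField m) (cotangentPart m 0) ⊗[ResidueField m]
      ExteriorAlgebra (ResidueField m) (cotangentPart m 1) :=
  1 ⊗ₜ ExteriorAlgebra.ι _ (p.oddBasis i)

theorem isAnticommuting_oddTensor : IsAnticommuting p.oddTensor :=
  (isAnticommuting_ι p.oddBasis).map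
    (Algebra.TensorProduct.includeRight (R := ResidueField m)
      (A := SymmetricAlgebra (ResidueField m) (cotangentPart m 0))).toRingHom

theorem isSymbol_kappa_top :
    IsSymbol m.toIdeal q p.top (kappa m (finsetProd p.oddTensor Finset.univ)) := by
  have h : IsSymbol m.toIdeal (Finset.univ : Finset (Fin q)).toList.length p.top
      (finsetProd (kappa m ∘ p.oddTensor) Finset.univ) :=
    IsSymbol.list_prod fun i _ => ⟨p.θ_mem i, by
      rw [Function.comp_apply, oddTensor, kappa_one_tmul_ι, p.θ_class]
      rfl⟩
  rw [Finset.length_toList, Finset.card_fin] at h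
  exact (map_finsetProd (kappa m : _ →+* Gr m) p.oddTensor Finset.univ).symm ▸ h

theorem top_mem_pow : p.top ∈ m.toIdeal ^ q := p.isSymbol_kappa_top.1

theorem isSymbol_kappa_toSymmetric {n : ℕ} {F : MvPolynomial (Fin r) (𝒜 0)}
    (hF : F.IsHomogeneous n) :
    IsSymbol m.toIdeal n (eval p.x F : A) (kappa m (p.toSymmetric F ⊗ₜ 1)) := by
  refine IsSymbol.of_isHomogeneous (ψ := (algebraMap (𝒜 0) A).comp (eval p.x))
    (φ := (kappa m).toRingHom.comp ((Algebra.TensorProduct.includeLeft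
      (R := ResidueField m) (S := ResidueField m)).toRingHom.comp p.toSymmetric))
    (fun c => ?_) (fun i => ?_) hF
  · change IsSymbol _ _ (eval p.x (C c) : A) (kappa m (p.toSymmetric (C c) ⊗ₜ 1))
    rw [eval_C, p.toSymmetric_C, ← Algebra.TensorProduct.algebraMap_apply, AlgHom.commutes]
    exact isSymbol_algebraMap m c
  · change IsSymbol _ _ (eval p.x (X i) : A) (kappa m (p.toSymmetric (X i) ⊗ₜ 1))
    rw [eval_X, p.toSymmetric_X, kappa_ι_tmul_one]
    exact ⟨p.x_mem i, by rw [p.x_class]; rfl⟩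

theorem isSymbol_kappa_smul_top {n : ℕ} {F : MvPolynomial (Fin r) (𝒜 0)} (hF : F.IsHomogeneous n) :
    IsSymbol m.toIdeal (n + q) ((eval p.x F : A) * p.top)
      (kappa m (p.toSymmetric F • finsetProd p.oddTensor Finset.univ)) := by
  have hsmul : p.toSymmetric F • finsetProd p.oddTensor Finset.univ =
      (p.toSymmetric F ⊗ₜ 1) * finsetProd p.oddTensor Finset.univ :=
    Algebra.smul_def (p.toSymmetric F) (finsetProd p.oddTensor Finset.univ)
  rw [hsmul, map_mul]
  exact (p.isSymbol_kappa_toSymmetric hF).mul p.isSymbol_kappa_top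

/-- The analogue of quasi-regularity for the even and odd parameters taken together: for a form `F`
of degree `n`, the element `F(x) θ₁ ⋯ θ_q` lies in `𝔪ⁿ⁺ᵠ⁺¹` only if `F` has all its coefficients in
`𝔪`. -/
def IsSuperQuasiRegular : Prop :=
  ∀ (n : ℕ) (F : MvPolynomial (Fin r) (𝒜 0)), F.IsHomogeneous n →
    (eval p.x F : A) * p.top ∈ m.toIdeal ^ (n + q + 1) → ∀ α, F.coeff α ∈ evenPart m

theorem isSuperQuasiRegular_of_kappa_injective (hκ : Function.Injective (kappa m)) :
    p.IsSuperQuasiRegular := fun _ _ hF hmem =>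
  p.toSymmetric_eq_zero_iff.1 (eq_zero_of_smul_finsetProd_one_tmul_ι_eq_zero p.oddBasis
    ((map_eq_zero_iff _ hκ).1 ((p.isSymbol_kappa_smul_top hF).eq_zero_iff.2 hmem)))

theorem kappa_injective_of_isSuperQuasiRegular (h : p.IsSuperQuasiRegular) :
    Function.Injective (kappa m) := by
  refine p.isAnticommuting_oddTensor.injective_of_top (kappa m : _ →+* Gr m)
    (span_finsetProd_one_tmul_ι p.oddBasis) fun f hf => ?_
  obtain ⟨F, rfl⟩ := p.toSymmetric_surjective f
  rw [p.toSymmetric_eq_zero_iff]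
  intro α
  have hsymbol (d : ℕ) := p.isSymbol_kappa_smul_top (homogeneousComponent_isHomogeneous d F)
  have hsum : ∑ d ∈ Finset.range (F.totalDegree + 1),
      kappa m (p.toSymmetric (homogeneousComponent d F) • finsetProd p.oddTensor Finset.univ) =
        0 := by
    rw [← map_sum, ← Finset.sum_smul, ← map_sum, sum_homogeneousComponent]
    exact hf
  have hcoeff : coeff α F = coeff α (homogeneousComponent α.degree F) := by
    rw [coeff_homogeneousComponent, if_pos rfl]
  by_cases hα : α.degree ∈ Finset.range (F.totalDegree + 1)
  · rw [hcoeff]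
    exact h _ _ (homogeneousComponent_isHomogeneous _ F)
      ((hsymbol _).eq_zero_iff.1 (IsSymbol.eq_zero_of_sum_eq_zero hsymbol hsum hα)) α
  · rw [hcoeff, homogeneousComponent_eq_zero _ _ (by simpa [Nat.lt_succ_iff] using hα), coeff_zero]
    exact zero_mem _

theorem kappa_injective_iff : Function.Injective (kappa m) ↔ p.IsSuperQuasiRegular :=
  ⟨p.isSuperQuasiRegular_of_kappa_injective, p.kappa_injective_of_isSuperQuasiRegular⟩

end Parameters

end Coordinates

section Regular

open MvPolynomial IsLocalRing

theorem ringKrullDim_quotient_top {S : Type*} [CommRing S] :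
    ringKrullDim (S ⧸ (⊤ : Ideal S)) = ⊥ :=
  have := Ideal.Quotient.subsingleton_iff.2 (rfl : (⊤ : Ideal S) = ⊤)
  ringKrullDim_eq_bot_of_subsingleton

variable {A : Type u} [Ring A] {𝒜 : ZMod 2 → AddSubgroup A} [GradedRing 𝒜]

theorem mem_evenAnnihilator {a : A} {b : 𝒜 0} : b ∈ evenAnnihilator 𝒜 a ↔ (b : A) * a = 0 :=
  Iff.rfl

theorem evenAnnihilator_neg (a : A) : evenAnnihilator 𝒜 (-a) = evenAnnihilator 𝒜 a :=
  Ideal.ext fun b => by rw [mem_evenAnnihilator, mem_evenAnnihilator, mul_neg, neg_eq_zero]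

theorem evenAnnihilator_zero : evenAnnihilator 𝒜 0 = ⊤ :=
  (Ideal.eq_top_iff_one _).2 (mul_zero _)

theorem evenAnnihilator_one : evenAnnihilator 𝒜 1 = ⊥ :=
  Ideal.ext fun b => by
    rw [mem_evenAnnihilator, mul_one, Ideal.mem_bot, ZeroMemClass.coe_eq_zero]

variable [SuperCommutative 𝒜]

theorem prod_ofFn_mem_component_pow {s : ℕ} (y : Fin s → 𝒜 1) :
    (List.ofFn fun i => (y i : A)).prod ∈ component 𝒜 1 ^ s := by
  induction s with
  | zero => rw [List.ofFn_zero, List.prod_nil, pow_zero]; exact Submodule.one_le.1 le_rfl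
  | succ s ih =>
    rw [List.ofFn_succ, List.prod_cons, pow_succ']
    exact Submodule.mul_mem_mul (y 0).2 (ih _)

theorem isSystemOfOddParameters_zero (y : Fin 0 → 𝒜 1) : IsSystemOfOddParameters 𝒜 y := by
  rw [IsSystemOfOddParameters, List.ofFn_zero, List.prod_nil, evenAnnihilator_one]
  exact (ringKrullDim_eq_of_ringEquiv (RingEquiv.quotientBot (𝒜 0))).symm

theorem IsSystemOfOddParameters.prod_ne_zero [Nontrivial (𝒜 0)] {s : ℕ} {y : Fin s → 𝒜 1}
    (hy : IsSystemOfOddParameters 𝒜 y) : (List.ofFn fun i => (y i : A)).prod ≠ 0 := by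
  intro h
  rw [IsSystemOfOddParameters, h, evenAnnihilator_zero, ringKrullDim_quotient_top] at hy
  exact absurd (hy ▸ ringKrullDim_nonneg_of_nontrivial) (by simp)

theorem exists_isSystemOfOddParameters {q : ℕ} (h : oddKrullDim 𝒜 = q) :
    ∃ y : Fin q → 𝒜 1, IsSystemOfOddParameters 𝒜 y := by
  cases q with
  | zero => exact ⟨Fin.elim0, isSystemOfOddParameters_zero _⟩
  | succ q =>
    by_contra hq
    have hle : oddKrullDim 𝒜 ≤ q := by
      refine iSup₂_le fun s hs => ?_
      have hsq : (s : ℕ∞) ≤ (q + 1 : ℕ) := h ▸ le_iSup₂_of_le s hs le_rfl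
      have hne : s ≠ q + 1 := by
        rintro rfl
        exact hq hs
      exact_mod_cast Nat.lt_succ_iff.1 (lt_of_le_of_ne (by exact_mod_cast hsq) hne)
    rw [h] at hle
    exact absurd (by exact_mod_cast hle) (Nat.not_succ_le_self q)

namespace Parameters

section Maximal

variable {m : HomogeneousIdeal 𝒜} [IsMaximalSuperIdeal m] {r q : ℕ} (p : Parameters m r q)
include p

theorem cotangentSuperDim_eq : cotangentSuperDim m = ((r : ℕ∞), (q : ℕ∞)) := by
  rw [cotangentSuperDim, rank_eq_card_basis p.evenBasis, rank_eq_card_basis p.oddBasis,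
    Fintype.card_fin, Fintype.card_fin, Cardinal.toENat_nat, Cardinal.toENat_nat]

theorem isRegular_iff : IsRegular m ↔ ringKrullDim (𝒜 0) = r ∧ oddKrullDim 𝒜 = q := by
  rw [IsRegular, p.cotangentSuperDim_eq, krullSuperDim, Prod.mk.injEq]
  rfl

theorem evenAnnihilator_prod_ofFn :
    evenAnnihilator 𝒜 (List.ofFn p.θ).prod = evenAnnihilator 𝒜 p.top := by
  rcases p.isAnticommuting.prod_ofFn_eq with h | h
  · rw [h, top]
  · rw [h, evenAnnihilator_neg, top]

variable {p} in
theorem IsSuperQuasiRegular.evenAnnihilator_top_ne_top (h : p.IsSuperQuasiRegular) :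
    evenAnnihilator 𝒜 p.top ≠ ⊤ := by
  intro htop
  have h1 : ((1 : 𝒜 0) : A) * p.top = 0 := (Ideal.eq_top_iff_one _).1 htop
  have hcoeff := h 0 (C 1) (isHomogeneous_C _ _) (by rw [eval_C, h1]; exact zero_mem _) 0
  rw [coeff_C, if_pos rfl] at hcoeff
  exact (Ideal.ne_top_iff_one _).1 (isMaximal_evenPart m).ne_top hcoeff

end Maximal

variable {m : HomogeneousIdeal 𝒜} [IsLocalSuperRing m] {r q : ℕ} (p : Parameters m r q)

theorem span_x_le_jacobson : Ideal.span (Set.range p.x) ≤ (⊥ : Ideal (𝒜 0)).jacobson :=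
  p.span_x_le.trans (evenPart_le_jacobson m)

variable (hA : IsNoetherianSuperRing 𝒜)
include p hA

theorem evenAnnihilator_top_le {a : A} (ha : a ∈ component 𝒜 1 ^ q) :
    evenAnnihilator 𝒜 p.top ≤ evenAnnihilator 𝒜 a := by
  rw [p.component_pow_eq_span_top hA] at ha
  obtain ⟨c, rfl⟩ := Submodule.mem_span_singleton.1 ha
  intro b hb
  rw [mem_evenAnnihilator] at hb ⊢
  rw [mul_smul_comm, hb, smul_zero]

theorem le_of_isSystemOfOddParameters {s : ℕ} {y : Fin s → 𝒜 1}
    (hy : IsSystemOfOddParameters 𝒜 y) : s ≤ q := by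
  by_contra! hs
  have := isLocalRing_even m
  have hmem := prod_ofFn_mem_component_pow y
  rw [p.component_pow_eq_bot hA hs, Submodule.mem_bot] at hmem
  exact hy.prod_ne_zero hmem

theorem oddKrullDim_eq_iff : oddKrullDim 𝒜 = q ↔
    ringKrullDim (𝒜 0) = ringKrullDim (𝒜 0 ⧸ evenAnnihilator 𝒜 p.top) := by
  constructor
  · intro h
    obtain ⟨y, hy⟩ := exists_isSystemOfOddParameters h
    have hle := p.evenAnnihilator_top_le hA (prod_ofFn_mem_component_pow y)
    refine le_antisymm (hy.le.trans ?_) (ringKrullDim_quotient_le _)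
    exact ringKrullDim_le_of_surjective (Ideal.Quotient.factor hle)
      (Ideal.Quotient.factor_surjective hle)
  · rw [← p.evenAnnihilator_prod_ofFn]
    intro h
    refine le_antisymm (iSup₂_le fun s ⟨y, hy⟩ => ?_)
      (le_iSup₂_of_le q ⟨fun i => ⟨p.θ i, p.θ_odd i⟩, h⟩ le_rfl)
    exact_mod_cast p.le_of_isSystemOfOddParameters hA hy

theorem span_mk_x [IsLocalRing (𝒜 0)] {I : Ideal (𝒜 0)} (hI : oddSqIdeal 𝒜 ≤ I)
    [IsLocalRing (𝒜 0 ⧸ I)] :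
    Ideal.span (Set.range (Ideal.Quotient.mk I ∘ p.x)) = maximalIdeal (𝒜 0 ⧸ I) := by
  rw [span_range_comp, ← map_mk_maximalIdeal, ← evenPart_eq_maximalIdeal m, p.evenPart_eq hA,
    Ideal.map_sup, Ideal.map_mk_eq_bot_of_le hI, sup_bot_eq]

theorem ringKrullDim_even_le : ringKrullDim (𝒜 0) ≤ r := by
  have := isLocalRing_even m
  have := isNoetherianRing_even 𝒜 hA
  have := isLocalRing_quotient
    (ne_top_of_le_ne_top Ideal.IsPrime.ne_top' (oddSqIdeal_le_of_isPrime (maximalIdeal (𝒜 0))))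
  rw [← ringKrullDim_quotient_oddSqIdeal]
  exact ringKrullDim_le_of_maximalIdeal_eq_span (p.span_mk_x hA le_rfl)

theorem isQuasiRegular_mk_x {I : Ideal (𝒜 0)} (hI : oddSqIdeal 𝒜 ≤ I) (hItop : I ≠ ⊤)
    (hdim : (r : WithBot ℕ∞) ≤ ringKrullDim (𝒜 0 ⧸ I)) :
    IsQuasiRegular (Ideal.Quotient.mk I ∘ p.x) := by
  have := isLocalRing_even m
  have := isNoetherianRing_even 𝒜 hA
  have := isLocalRing_quotient hItop
  exact isQuasiRegular_of_le_ringKrullDim hdim (p.span_mk_x hA hI)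

theorem evenAnnihilator_top_eq_oddSqIdeal (hreg : IsRegular m) :
    evenAnnihilator 𝒜 p.top = oddSqIdeal 𝒜 := by
  have := isLocalRing_even m
  have := isNoetherianRing_even 𝒜 hA
  obtain ⟨hr, hq⟩ := p.isRegular_iff.1 hreg
  rw [p.oddKrullDim_eq_iff hA, hr] at hq
  have htop : evenAnnihilator 𝒜 p.top ≠ ⊤ := by
    intro h
    rw [h, ringKrullDim_quotient_top] at hq
    exact absurd hq (by simp)
  have hle := p.oddSqIdeal_le_evenAnnihilator hA
  refine le_antisymm ((p.isQuasiRegular_mk_x hA hle htop hq.le).le_of_le_sup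
    p.span_x_le_jacobson hle ?_) hle
  rw [← p.evenPart_eq hA, evenPart_eq_maximalIdeal m]
  exact le_maximalIdeal htop

theorem isSuperQuasiRegular_of_isRegular (hreg : IsRegular m) : p.IsSuperQuasiRegular := by
  intro n F hF hmem α
  have := isNoetherianRing_even 𝒜 hA
  have hann := p.evenAnnihilator_top_eq_oddSqIdeal hA hreg
  have hprime := isMaximal_evenPart m
  have hquasi := p.isQuasiRegular_mk_x hA le_rfl
    (ne_top_of_le_ne_top hprime.ne_top (oddSqIdeal_le_of_isPrime (evenPart m)))
    (by rw [ringKrullDim_quotient_oddSqIdeal, (p.isRegular_iff.1 hreg).1])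
  have hmul : (eval p.x F : A) * p.top ∈
      Ideal.span (Set.range p.x) ^ (n + q + 1 - Fintype.card (Fin q)) •
        Submodule.span (𝒜 0) {p.top} := by
    refine p.isAnticommuting.mem_pow_smul_of_mem_mixedPow (I := oddSqIdeal 𝒜)
      (fun k g hg hgtop => ?_) ?_ (Submodule.smul_mem _ (eval p.x F)
        (Submodule.mem_span_singleton_self _)) ?_
    · rw [mul_comm]
      exact hquasi.inf_pow_le_mul_pow p.span_x_le_jacobson k ⟨hann.le hgtop, hg⟩
    · rw [p.span_θ hA]
      exact oddSqIdeal_smul_one_le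
    · rw [p.span_θ hA]
      exact mem_mixedPow_of_mem_pow (p.evenPart_eq hA).le _ hmem
  obtain ⟨g, hg, hgF⟩ := Submodule.mem_smul_span_singleton.1 hmul
  rw [Fintype.card_fin, show n + q + 1 - q = n + 1 by omega] at hg
  have hsub : eval p.x F - g ∈ oddSqIdeal 𝒜 := by
    rw [← hann, mem_evenAnnihilator, AddSubgroup.coe_sub, sub_mul, ← hgF]
    exact sub_self _
  rw [p.evenPart_eq hA]
  refine (isQuasiRegular_mk_iff _ _).1 hquasi n F hF ?_ α
  rw [← add_sub_cancel g (eval p.x F)]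
  exact Submodule.add_mem_sup hg hsub

variable {p} in
theorem IsSuperQuasiRegular.isQuasiRegular_mk (h : p.IsSuperQuasiRegular) :
    IsQuasiRegular (Ideal.Quotient.mk (evenAnnihilator 𝒜 p.top) ∘ p.x) := by
  rw [isQuasiRegular_mk_iff]
  intro n F hF hev α
  refine sup_le_sup_left (p.oddSqIdeal_le_evenAnnihilator hA) _
    ((p.evenPart_eq hA).le (h n F hF ?_ α))
  obtain ⟨g, hg, b, hb, hgb⟩ := Submodule.mem_sup.1 hev
  rw [← hgb, AddSubgroup.coe_add, add_mul, mem_evenAnnihilator.1 hb, add_zero, add_right_comm]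
  exact mul_mem_pow_add (coe_mem_pow (Ideal.pow_right_mono p.span_x_le _ hg)) p.top_mem_pow

theorem isRegular_of_isSuperQuasiRegular (h : p.IsSuperQuasiRegular) : IsRegular m := by
  have := isLocalRing_even m
  have := isNoetherianRing_even 𝒜 hA
  have := isLocalRing_quotient h.evenAnnihilator_top_ne_top
  have hle := p.ringKrullDim_even_le hA
  have hquot := ringKrullDim_quotient_le (evenAnnihilator 𝒜 p.top)
  have hge := (h.isQuasiRegular_mk hA).le_ringKrullDim (by
    rw [p.span_mk_x hA (p.oddSqIdeal_le_evenAnnihilator hA)]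
    exact Ideal.IsPrime.ne_top')
  exact p.isRegular_iff.2 ⟨le_antisymm hle (hge.trans hquot),
    (p.oddKrullDim_eq_iff hA).2 (le_antisymm (hle.trans hge) hquot)⟩

theorem isRegular_iff_isSuperQuasiRegular : IsRegular m ↔ p.IsSuperQuasiRegular :=
  ⟨p.isSuperQuasiRegular_of_isRegular hA, p.isRegular_of_isSuperQuasiRegular hA⟩

end Parameters

end Regular

end SuperRing

theorem mainTheorem1 {A : Type*} [Ring A] (𝒜 : ZMod 2 → AddSubgroup A) [GradedRing 𝒜]
    [SuperRing.SuperCommutative 𝒜] (hA : SuperRing.IsNoetherianSuperRing 𝒜)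
    (m : HomogeneousIdeal 𝒜) [SuperRing.IsLocalSuperRing m] :
    Function.Surjective (SuperRing.kappa m) ∧
      (SuperRing.IsRegular m ↔ Function.Bijective (SuperRing.kappa m)) := by
  have hsurj := SuperRing.kappa_surjective m
  obtain ⟨r, q, ⟨p⟩⟩ := SuperRing.exists_parameters m hA
  refine ⟨hsurj, ?_⟩
  rw [p.isRegular_iff_isSuperQuasiRegular hA, ← p.kappa_injective_iff]
  exact ⟨fun hinj => ⟨hinj, hsurj⟩, And.left⟩
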